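/- A stretched coupled-task $t_i$ with stretch factor $\alpha_i\in\mathbb{Z}_{>0}$ consists of two sub-tasks of duration $\alpha_i$ each, the second starting exactly $\alpha_i$ time units after the end of the first (its idle time); it thus occupies an interval of length $3\alpha_i$ from its starting time. An instance of $1|\alpha(t_i),G|C_{\max}$ consists of $n$ stretched coupled-tasks and a compatibility graph $G$ on the set of tasks. A schedule assigns to every task a starting time $s_i\ge 0$ (a real number) so that at any time at most one sub-task is executed, and a sub-task of $t_i$ is executed during the idle time of another task $t_j$ only if $t_i$ and $t_j$ are adjacent in $G$. The makespan is $\max_i (s_i+3\alpha_i)$ ($0$ if $n=0$), to be minimized. **Theorem.** The problem $1|\alpha(t_i),G=\text{chain}|C_{\max}$, in which $G$ is a path on all $n$ tasks, can be solved in time $O(n^3)$ and in polynomial time. Precisely: there is one program for a random access machine with addition, truncated subtraction, comparison and indirect addressing on natural numbers which, for every $n$ and every such instance, given by $n$, the stretch factors (in binary) and the adjacency matrix of $G$ (the tasks being numbered arbitrarily), halts with the (integer) starting times of a schedule of minimum makespan and with the value of the minimum makespan. It performs $O(n^3)$ steps, with an absolute constant (at most $C(n^3+1)$ steps for some constant $C$),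 and its logarithmic cost, in which every step is charged one plus the number of binary digits of the numbers and addresses it works on, is bounded by a polynomial in the number of binary digits of the input. -/

import Mathlib

/-! ## A random access machine

Values are natural numbers. A state has registers, named by constants of the program, and a
memory that is addressed by register contents. The arithmetic is addition and truncated subtraction
only. Control flow is structured. -/

namespace RAM

structure State where
  reg : ℕ → ℕ
  mem : ℕ → ℕ

/-- The state with `v` written to register `x`. -/
def State.setReg (s : State) (x v : ℕ) : State := ⟨Function.update s.reg x v, s.mem⟩

/-- The state with `v` written to memory cell `a`. -/
def State.setMem (s : State) (a v : ℕ) : State := ⟨s.reg, Function.update s.mem a v⟩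

/-- Programs. The arguments `x y z` name registers. -/
inductive Program where
  /-- do nothing -/
  | skip : Program
  /-- `x := k`, for a constant `k` of the program -/
  | const (x k : ℕ) : Program
  /-- `x := y + z` -/
  | add (x y z : ℕ) : Program
  /-- `x := max (y - z) 0` -/
  | sub (x y z : ℕ) : Program
  /-- `x := mem[y]` -/
  | load (x y : ℕ) : Program
  /-- `mem[x] := y` -/
  | store (x y : ℕ) : Program
  /-- `p; q` -/
  | seq (p q : Program) : Program
  /-- `if x < y then p else q` -/
  | ifLt (x y : ℕ) (p q : Program) : Program
  /-- `while x < y do p` -/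
  | whileLt (x y : ℕ) (p : Program) : Program

/-- `Exec p s t c s'`: started in state `s`, the program `p` terminates in state `s'` after `t`
steps (unit cost: every executed instruction and every evaluated test counts one), and its
logarithmic cost is `c` (every step is charged one plus the number of binary digits of the constant,
the addresses and the values it works on). -/
inductive Exec : Program → State → ℕ → ℕ → State → Prop
  | skip (s : State) : Exec .skip s 1 1 s
  | const (x k : ℕ) (s : State) :
      Exec (.const x k) s 1 (1 + k.size) (s.setReg x k)
  | add (x y z : ℕ) (s : State) :
      Exec (.add x y z) s 1 (1 + (s.reg y).size + (s.reg z).size)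
        (s.setReg x (s.reg y + s.reg z))
  | sub (x y z : ℕ) (s : State) :
      Exec (.sub x y z) s 1 (1 + (s.reg y).size + (s.reg z).size)
        (s.setReg x (s.reg y - s.reg z))
  | load (x y : ℕ) (s : State) :
      Exec (.load x y) s 1 (1 + (s.reg y).size + (s.mem (s.reg y)).size)
        (s.setReg x (s.mem (s.reg y)))
  | store (x y : ℕ) (s : State) :
      Exec (.store x y) s 1 (1 + (s.reg x).size + (s.reg y).size)
        (s.setMem (s.reg x) (s.reg y))
  | seq {p q : Program} {s s₁ s₂ : State} {t₁ t₂ c₁ c₂ : ℕ}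
      (hp : Exec p s t₁ c₁ s₁) (hq : Exec q s₁ t₂ c₂ s₂) :
      Exec (.seq p q) s (t₁ + t₂) (c₁ + c₂) s₂
  | ifTrue {x y : ℕ} {p q : Program} {s s₁ : State} {t c : ℕ}
      (h : s.reg x < s.reg y) (hp : Exec p s t c s₁) :
      Exec (.ifLt x y p q) s (1 + t) (1 + (s.reg x).size + (s.reg y).size + c) s₁
  | ifFalse {x y : ℕ} {p q : Program} {s s₁ : State} {t c : ℕ}
      (h : ¬ s.reg x < s.reg y) (hq : Exec q s t c s₁) :
      Exec (.ifLt x y p q) s (1 + t) (1 + (s.reg x).size + (s.reg y).size + c) s₁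
  | whileTrue {x y : ℕ} {p : Program} {s s₁ s₂ : State} {t₁ t₂ c₁ c₂ : ℕ}
      (h : s.reg x < s.reg y) (hp : Exec p s t₁ c₁ s₁)
      (hw : Exec (.whileLt x y p) s₁ t₂ c₂ s₂) :
      Exec (.whileLt x y p) s (1 + t₁ + t₂)
        (1 + (s.reg x).size + (s.reg y).size + c₁ + c₂) s₂
  | whileFalse {x y : ℕ} {p : Program} {s : State} (h : ¬ s.reg x < s.reg y) :
      Exec (.whileLt x y p) s 1 (1 + (s.reg x).size + (s.reg y).size) s

end RAM

/-! ## Stretched coupled-tasks with a compatibility graph -/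

namespace CoupledTasks

/-- An instance with `n` stretched coupled-tasks: task `i` has two sub-tasks of duration
`stretch i`, separated by an idle time of exactly `stretch i`. -/
structure Instance (n : ℕ) where
  stretch : Fin n → ℕ
  stretch_pos : ∀ i, 0 < stretch i
  compat : SimpleGraph (Fin n)

namespace Instance

variable {n : ℕ}

/-- The time during which the machine executes one of the two sub-tasks of task `i`, when task `i`
starts at time `s i`. -/
def busy (I : Instance n) (s : Fin n → ℝ) (i : Fin n) : Set ℝ :=
  Set.Ico (s i) (s i + I.stretch i) ∪ Set.Ico (s i + 2 * I.stretch i) (s i + 3 * I.stretch i)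

/-- The idle time of task `i`, when task `i` starts at time `s i`. -/
def idle (I : Instance n) (s : Fin n → ℝ) (i : Fin n) : Set ℝ :=
  Set.Ico (s i + I.stretch i) (s i + 2 * I.stretch i)

/-- `s`, giving the starting time of every task, is a valid schedule on one machine. -/
structure IsSchedule (I : Instance n) (s : Fin n → ℝ) : Prop where
  nonneg : ∀ i, 0 ≤ s i
  /-- The machine executes at most one sub-task at a time. -/
  machine : ∀ i j, i ≠ j → Disjoint (I.busy s i) (I.busy s j)
  /-- A sub-task is executed during the idle time of another task only if the two tasks are
  compatible. -/
  compatible : ∀ i j, i ≠ j → ¬ I.compat.Adj i j → Disjoint (I.busy s i) (I.idle s j)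

/-- The completion time of the latest task (`0` if there is no task). -/
noncomputable def makespan (I : Instance n) (s : Fin n → ℝ) : ℝ :=
  ⨆ i, (s i + 3 * I.stretch i)

/-- `s` is a valid schedule of minimum makespan. -/
def IsOptimal (I : Instance n) (s : Fin n → ℝ) : Prop :=
  I.IsSchedule s ∧ ∀ s', I.IsSchedule s' → I.makespan s ≤ I.makespan s'

/-- The compatibility graph is a chain: a path through all the tasks, in an arbitrary and unknown
order. -/
def IsChain (I : Instance n) : Prop :=
  Nonempty (SimpleGraph.pathGraph n ≃g I.compat)

open Classical in
/-- The memory that holds the instance: cell `i` holds the stretch factor of task `i`, and cell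
`n + i * n + j` holds the entry `(i, j)` of the adjacency matrix of the compatibility graph. All
other cells hold `0`. -/
noncomputable def inputMem (I : Instance n) (a : ℕ) : ℕ :=
  if h : a < n then I.stretch ⟨a, h⟩
  else if ∃ i j : Fin n, a = n + i * n + j ∧ I.compat.Adj i j then 1 else 0

/-- The initial state: register `0` holds the number of tasks, the other registers hold `0`. -/
noncomputable def input (I : Instance n) : RAM.State :=
  ⟨fun x => if x = 0 then n else 0, I.inputMem⟩

/-- The number of binary digits of the input. -/
def inputLength (I : Instance n) : ℕ :=
  n.size + ∑ i, (I.stretch i).size + n * n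

end Instance

end CoupledTasks

/-! ### Program logic and cost bounds for the machine -/

namespace RAM

/-! Two tasks that never keep the machine busy together are apart, nested (one inside the idle time
of the other), or interleaved with equal stretch factors (`disjoint_busy_iff`). Incompatible tasks
must be apart (`IsSchedule.apart`), so on a path only consecutive tasks overlap. Read from the left,
a schedule then splits into blocks: a single task; two consecutive tasks `k`, `k + 1`, interleaved
or nested; or three, with `k` and `k + 2` both inside the idle time of `k + 1`. This gives the
recurrence `IsDPStep` for the cost `E k` of the tasks from position `k` on.

The blocks of a schedule need not appear in path order, so the lower bound compares measures instead
of times: the time occupied by the tasks from `k` on has Lebesgue measure at least `E k`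
(`le_volume_occupied`), because the first block covers an interval that all later tasks avoid. All
occupied time lies between `0` and the makespan, so `E 0` bounds the makespan from below
(`IsOrder.le_makespan`). Conversely, placing the chosen blocks one after another in path order gives
a schedule of makespan `E 0` (`Placed.extend`, `IsOrder.isOptimal`).

The program must first recover the order of the path. For every task it sums the labels of the
neighbours. Starting from a task of degree below two, the next task is this sum minus the label of
the previous task (`IsOrder.sum_adj`). Reading the matrix takes quadratic time, and the walk, the
recurrence and the output take linear time, so `chainProgram_ends` gives a quadratic bound. Since a
step lengthens numbers by at most one digit, the logarithmic cost is polynomial as well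
(`Exec.cost_le`). -/

@[simp] theorem State.reg_setReg (s : State) (x v y : ℕ) :
    (s.setReg x v).reg y = if y = x then v else s.reg y := by
  simp [State.setReg, Function.update_apply]

@[simp] theorem State.mem_setReg (s : State) (x v a : ℕ) : (s.setReg x v).mem a = s.mem a := rfl

@[simp] theorem State.reg_setMem (s : State) (a v y : ℕ) : (s.setMem a v).reg y = s.reg y := rfl

@[simp] theorem State.mem_setMem (s : State) (a v b : ℕ) :
    (s.setMem a v).mem b = if b = a then v else s.mem b := by
  simp [State.setMem, Function.update_apply]

/-- Started in `s`, the program terminates within `T` steps in a state satisfying `Q`. -/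
def Ends (P : Program) (s : State) (T : ℕ) (Q : State → Prop) : Prop :=
  ∃ t c s', Exec P s t c s' ∧ t ≤ T ∧ Q s'

theorem Ends.mono {P : Program} {s : State} {T T' : ℕ} {Q Q' : State → Prop}
    (h : Ends P s T Q) (hT : T ≤ T') (hQ : ∀ s, Q s → Q' s) : Ends P s T' Q' := by
  obtain ⟨t, c, s', he, ht, hq⟩ := h
  exact ⟨t, c, s', he, ht.trans hT, hQ _ hq⟩

theorem Ends.seq {p q : Program} {s : State} {T₁ T₂ : ℕ} {Q R : State → Prop}
    (hp : Ends p s T₁ Q) (hq : ∀ s', Q s' → Ends q s' T₂ R) :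
    Ends (.seq p q) s (T₁ + T₂) R := by
  obtain ⟨t, c, s', he, ht, hs⟩ := hp
  obtain ⟨t', c', s'', he', ht', hs'⟩ := hq s' hs
  exact ⟨_, _, s'', .seq he he', by omega, hs'⟩

/-- A loop whose invariant `Inv m` carries a bound `m` on the number of remaining rounds. -/
theorem Ends.while {x y : ℕ} {p : Program} {T : ℕ} (Inv : ℕ → State → Prop)
    (body : ∀ m s, Inv m s → s.reg x < s.reg y →
      Ends p s T (fun s' => ∃ m', m' < m ∧ Inv m' s')) :
    ∀ m s, Inv m s →
      Ends (.whileLt x y p) s (m * (T + 1) + 1)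
        (fun s' => (∃ m', Inv m' s') ∧ ¬ s'.reg x < s'.reg y) := by
  intro m
  induction m using Nat.strong_induction_on with
  | _ m ih =>
    intro s hs
    by_cases h : s.reg x < s.reg y
    · obtain ⟨t, c, s', he, ht, m', hm, hs'⟩ := body m s hs h
      obtain ⟨t', c', s'', he', ht', hq⟩ := ih m' hm s' hs'
      refine ⟨_, _, s'', .whileTrue h he he', ?_, hq⟩
      obtain ⟨d, rfl⟩ := Nat.exists_eq_add_of_lt hm
      have : (m' + d + 1) * (T + 1) = m' * (T + 1) + d * (T + 1) + (T + 1) := by ring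
      omega
    · exact ⟨_, _, s, .whileFalse h, by omega, ⟨m, hs⟩, h⟩

/-- Weakest precondition of a loop-free program. -/
def wp : Program → State → (State → Prop) → Prop
  | .skip, s, Q => Q s
  | .const x k, s, Q => Q (s.setReg x k)
  | .add x y z, s, Q => Q (s.setReg x (s.reg y + s.reg z))
  | .sub x y z, s, Q => Q (s.setReg x (s.reg y - s.reg z))
  | .load x y, s, Q => Q (s.setReg x (s.mem (s.reg y)))
  | .store x y, s, Q => Q (s.setMem (s.reg x) (s.reg y))
  | .seq p q, s, Q => wp p s (fun s' => wp q s' Q)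
  | .ifLt x y p q, s, Q =>
      (s.reg x < s.reg y → wp p s Q) ∧ (¬ s.reg x < s.reg y → wp q s Q)
  | .whileLt _ _ _, _, _ => False

/-- A bound on the number of steps of a loop-free program. -/
def loopFreeTime : Program → ℕ
  | .seq p q => loopFreeTime p + loopFreeTime q
  | .ifLt _ _ p q => 1 + loopFreeTime p + loopFreeTime q
  | _ => 1

theorem Ends.of_wp {P : Program} {s : State} {Q : State → Prop} (h : wp P s Q) :
    Ends P s (loopFreeTime P) Q := by
  induction P generalizing s Q with
  | skip => exact ⟨_, _, _, .skip s, le_rfl, h⟩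
  | const x k => exact ⟨_, _, _, .const x k s, le_rfl, h⟩
  | add x y z => exact ⟨_, _, _, .add x y z s, le_rfl, h⟩
  | sub x y z => exact ⟨_, _, _, .sub x y z s, le_rfl, h⟩
  | load x y => exact ⟨_, _, _, .load x y s, le_rfl, h⟩
  | store x y => exact ⟨_, _, _, .store x y s, le_rfl, h⟩
  | seq p q ihp ihq => exact (ihp h).seq fun s' hs' => ihq hs'
  | ifLt x y p q ihp ihq =>
    simp only [loopFreeTime]
    by_cases hlt : s.reg x < s.reg y
    · obtain ⟨t, c, s', he, ht, hq⟩ := ihp (h.1 hlt)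
      exact ⟨_, _, s', .ifTrue hlt he, by omega, hq⟩
    · obtain ⟨t, c, s', he, ht, hq⟩ := ihq (h.2 hlt)
      exact ⟨_, _, s', .ifFalse hlt he, by omega, hq⟩
  | whileLt x y p => exact h.elim

theorem wp_mono {P : Program} {s : State} {Q R : State → Prop} (h : wp P s Q)
    (hQR : ∀ s, Q s → R s) : wp P s R := by
  induction P generalizing s Q R with
  | seq p q ihp ihq => exact ihp h fun s' hs' => ihq hs' hQR
  | ifLt x y p q ihp ihq => exact ⟨fun hl => ihp (h.1 hl) hQR, fun hl => ihq (h.2 hl) hQR⟩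
  | whileLt x y p => exact h.elim
  | _ => exact hQR _ h

/-! ### Logarithmic cost -/

/-- All constants of the program have at most `B` binary digits. -/
def ConstSizeLE (B : ℕ) : Program → Prop
  | .const _ k => k.size ≤ B
  | .seq p q => ConstSizeLE B p ∧ ConstSizeLE B q
  | .ifLt _ _ p q => ConstSizeLE B p ∧ ConstSizeLE B q
  | .whileLt _ _ p => ConstSizeLE B p
  | _ => True

theorem ConstSizeLE.mono {B B' : ℕ} (hB : B ≤ B') {P : Program} (h : ConstSizeLE B P) :
    ConstSizeLE B' P := by
  induction P with
  | const x k => exact le_trans h hB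
  | seq p q ihp ihq => exact ⟨ihp h.1, ihq h.2⟩
  | ifLt x y p q ihp ihq => exact ⟨ihp h.1, ihq h.2⟩
  | whileLt x y p ih => exact ih h
  | _ => trivial

/-- All numbers held by the state have at most `B` binary digits. -/
def State.SizeLE (B : ℕ) (s : State) : Prop :=
  (∀ x, (s.reg x).size ≤ B) ∧ ∀ a, (s.mem a).size ≤ B

theorem State.SizeLE.mono {B B' : ℕ} {s : State} (h : s.SizeLE B) (hB : B ≤ B') : s.SizeLE B' :=
  ⟨fun x => (h.1 x).trans hB, fun a => (h.2 a).trans hB⟩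

theorem State.SizeLE.setReg {B : ℕ} {s : State} (h : s.SizeLE B) (x : ℕ) {v : ℕ}
    (hv : v.size ≤ B) : (s.setReg x v).SizeLE B := by
  refine ⟨fun y => ?_, h.2⟩
  rw [State.reg_setReg]
  split_ifs
  exacts [hv, h.1 y]

theorem State.SizeLE.setMem {B : ℕ} {s : State} (h : s.SizeLE B) (a : ℕ) {v : ℕ}
    (hv : v.size ≤ B) : (s.setMem a v).SizeLE B := by
  refine ⟨h.1, fun b => ?_⟩
  rw [State.mem_setMem]
  split_ifs
  exacts [hv, h.2 b]

theorem size_add_le {a b B : ℕ} (ha : a.size ≤ B) (hb : b.size ≤ B) : (a + b).size ≤ B + 1 := by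
  rw [Nat.size_le] at *
  rw [pow_succ]
  omega

/-- Numbers grow by at most one digit per step, so the logarithmic cost is polynomially bounded in
the number of steps. -/
theorem Exec.cost_le {P : Program} {s s' : State} {t c : ℕ} (h : Exec P s t c s') :
    ∀ B, ConstSizeLE B P → s.SizeLE B →
      s'.SizeLE (B + t) ∧ c ≤ t * (1 + 2 * (B + t)) := by
  induction h with
  | skip s => intro B _ hs; exact ⟨hs.mono (by omega), by omega⟩
  | const x k s =>
    intro B hP hs
    have hk : k.size ≤ B := hP
    exact ⟨(hs.setReg x hk).mono (by omega), by omega⟩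
  | add x y z s =>
    intro B _ hs
    have h1 := hs.1 y
    have h2 := hs.1 z
    exact ⟨(hs.mono (by omega)).setReg x (size_add_le h1 h2), by omega⟩
  | sub x y z s =>
    intro B _ hs
    have h1 := hs.1 y
    have h2 := hs.1 z
    have h3 : (s.reg y - s.reg z).size ≤ B :=
      (Nat.size_le_size (Nat.sub_le _ _)).trans h1
    exact ⟨(hs.setReg x h3).mono (by omega), by omega⟩
  | load x y s =>
    intro B _ hs
    have h1 := hs.1 y
    have h2 := hs.2 (s.reg y)
    exact ⟨(hs.setReg x h2).mono (by omega), by omega⟩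
  | store x y s =>
    intro B _ hs
    have h1 := hs.1 y
    have h2 := hs.1 x
    exact ⟨(hs.setMem _ h1).mono (by omega), by omega⟩
  | seq hp hq ihp ihq =>
    intro B hP hs
    obtain ⟨h1, h2⟩ := ihp B hP.1 hs
    obtain ⟨h3, h4⟩ := ihq _ (hP.2.mono (by omega)) h1
    exact ⟨h3.mono (by omega), by nlinarith⟩
  | @ifTrue x y p q s s₁ t c h hp ih =>
    intro B hP hs
    obtain ⟨h1, h2⟩ := ih B hP.1 hs
    have h3 := hs.1 x
    have h4 := hs.1 y
    exact ⟨h1.mono (by omega), by nlinarith⟩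
  | @ifFalse x y p q s s₁ t c h hp ih =>
    intro B hP hs
    obtain ⟨h1, h2⟩ := ih B hP.2 hs
    have h3 := hs.1 x
    have h4 := hs.1 y
    exact ⟨h1.mono (by omega), by nlinarith⟩
  | @whileTrue x y p s s₁ s₂ t₁ t₂ c₁ c₂ h hp hw ihp ihw =>
    intro B hP hs
    obtain ⟨h1, h2⟩ := ihp B hP hs
    obtain ⟨h3, h4⟩ := ihw _ (ConstSizeLE.mono (by omega) (P := .whileLt x y p) hP) h1
    have h5 := hs.1 x
    have h6 := hs.1 y
    exact ⟨h3.mono (by omega), by nlinarith⟩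
  | @whileFalse x y p s h =>
    intro B _ hs
    have h3 := hs.1 x
    have h4 := hs.1 y
    exact ⟨hs.mono (by omega), by omega⟩

end RAM

namespace CoupledTasks

open MeasureTheory

/-! ### Relative positions of two tasks -/

section Placement

variable {R : Type*} [Semiring R] [PartialOrder R]

/-- A task of stretch factor `a` started at `p` and one of stretch factor `c` started at `q` do not
overlap. -/
def Apart (p a q c : R) : Prop := p + 3 * a ≤ q ∨ q + 3 * c ≤ p

/-- The task `(q, c)` is executed during the idle time of the task `(p, a)`. -/
def Inside (q c p a : R) : Prop := p + a ≤ q ∧ q + 3 * c ≤ p + 2 * a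

/-- The first sub-task of `(q, c)` fills the idle time of `(p, a)`, and the second sub-task of
`(p, a)` fills the idle time of `(q, c)`. -/
def Interleaved (p a q c : R) : Prop := a = c ∧ q = p + a

/-- The two tasks never keep the machine busy at the same time. -/
def Fits (p a q c : R) : Prop :=
  Apart p a q c ∨ Inside q c p a ∨ Inside p a q c ∨ Interleaved p a q c ∨ Interleaved q c p a

theorem Apart.symm {p a q c : R} (h : Apart p a q c) : Apart q c p a := Or.symm h

theorem Fits.symm {p a q c : R} (h : Fits p a q c) : Fits q c p a := by
  unfold Fits at *
  rcases h with h | h | h | h | h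
  exacts [.inl h.symm, .inr (.inr (.inl h)), .inr (.inl h), .inr (.inr (.inr (.inr h))),
    .inr (.inr (.inr (.inl h)))]

end Placement

theorem Apart.cast {p a q c : ℕ} (h : Apart p a q c) : Apart (p : ℝ) a q c := by
  unfold Apart at *; exact_mod_cast h

theorem Fits.cast {p a q c : ℕ} (h : Fits p a q c) : Fits (p : ℝ) a q c := by
  unfold Fits Apart Inside Interleaved at *; exact_mod_cast h

theorem disjoint_Ico {p p' q q' : ℝ} (hp : p < p') (hq : q < q') :
    Disjoint (Set.Ico p p') (Set.Ico q q') ↔ p' ≤ q ∨ q' ≤ p := by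
  rw [Set.Ico_disjoint_Ico]
  constructor
  · intro h
    rcases le_total p' q' with h1 | h1 <;> rcases le_total p q with h2 | h2 <;>
      simp only [h1, h2, min_eq_left, min_eq_right, max_eq_left, max_eq_right] at h <;>
      first
        | exact Or.inl h
        | exact Or.inr h
        | linarith
  · rintro (h | h)
    · exact (min_le_left _ _).trans (h.trans (le_max_right _ _))
    · exact (min_le_right _ _).trans (h.trans (le_max_left _ _))

theorem Apart.disjoint {p a q c : ℝ} (h : Apart p a q c) :
    Disjoint (Set.Ico p (p + 3 * a)) (Set.Ico q (q + 3 * c)) := by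
  rw [Set.disjoint_left]
  rintro x ⟨h1, h2⟩ ⟨h3, h4⟩
  rcases h with h | h <;> linarith

namespace Instance

variable {n : ℕ} (I : Instance n)

theorem stretch_pos_real (i : Fin n) : (0 : ℝ) < I.stretch i := Nat.cast_pos.2 (I.stretch_pos i)

/-- Each of the four pairs of sub-tasks must be ordered one way or the other, and only five patterns
are consistent. When a sub-task of each lies in the idle time of the other, the inequalities close
up to equalities, which is interleaving. -/
theorem disjoint_busy_iff (s : Fin n → ℝ) (i j : Fin n) :
    Disjoint (I.busy s i) (I.busy s j) ↔ Fits (s i) (I.stretch i) (s j) (I.stretch j) := by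
  have hi := I.stretch_pos_real i
  have hj := I.stretch_pos_real j
  unfold busy
  rw [Set.disjoint_union_left, Set.disjoint_union_right, Set.disjoint_union_right,
    disjoint_Ico (by linarith) (by linarith), disjoint_Ico (by linarith) (by linarith),
    disjoint_Ico (by linarith) (by linarith), disjoint_Ico (by linarith) (by linarith)]
  generalize (I.stretch i : ℝ) = a at *
  generalize (I.stretch j : ℝ) = c at *
  generalize s i = p
  generalize s j = q
  unfold Fits Apart Inside Interleaved
  constructor
  · rintro ⟨⟨h1, h2⟩, h3, h4⟩
    rcases h1 with h1 | h1
    · rcases h3 with h3 | h3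
      · exact .inl (.inl (by linarith))
      · rcases h4 with h4 | h4
        · exact .inr (.inr (.inr (.inl ⟨by linarith, by linarith⟩)))
        · exact .inr (.inl ⟨by linarith, by linarith⟩)
    · rcases h2 with h2 | h2
      · rcases h4 with h4 | h4
        · exact .inr (.inr (.inl ⟨by linarith, by linarith⟩))
        · exact .inr (.inr (.inr (.inr ⟨by linarith, by linarith⟩)))
      · exact .inl (.inr (by linarith))
  · rintro ((h | h) | ⟨h, h'⟩ | ⟨h, h'⟩ | ⟨h, h'⟩ | ⟨h, h'⟩)
    · exact ⟨⟨.inl (by linarith), .inl (by linarith)⟩, .inl (by linarith), .inl (by linarith)⟩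
    · exact ⟨⟨.inr (by linarith), .inr (by linarith)⟩, .inr (by linarith), .inr (by linarith)⟩
    · exact ⟨⟨.inl (by linarith), .inl (by linarith)⟩, .inr (by linarith), .inr (by linarith)⟩
    · exact ⟨⟨.inr (by linarith), .inl (by linarith)⟩, .inr (by linarith), .inl (by linarith)⟩
    · exact ⟨⟨.inl (by linarith), .inl (by linarith)⟩, .inr (by linarith), .inl (by linarith)⟩
    · exact ⟨⟨.inr (by linarith), .inl (by linarith)⟩, .inr (by linarith), .inr (by linarith)⟩

theorem disjoint_idle_of_apart {s : Fin n → ℝ} {i j : Fin n}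
    (h : Apart (s i) (I.stretch i) (s j) (I.stretch j)) :
    Disjoint (I.busy s i) (I.idle s j) := by
  have hi := I.stretch_pos_real i
  have hj := I.stretch_pos_real j
  refine Disjoint.mono ?_ ?_ h.disjoint
  · rintro x (⟨h1, h2⟩ | ⟨h1, h2⟩) <;> exact ⟨by linarith, by linarith⟩
  · rintro x ⟨h1, h2⟩
    exact ⟨by linarith, by linarith⟩

theorem IsSchedule.fits {I : Instance n} {s : Fin n → ℝ} (h : I.IsSchedule s) {i j : Fin n}
    (hij : i ≠ j) : Fits (s i) (I.stretch i) (s j) (I.stretch j) :=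
  (I.disjoint_busy_iff s i j).1 (h.machine i j hij)

/-- Incompatible tasks do not overlap at all. -/
theorem IsSchedule.apart {I : Instance n} {s : Fin n → ℝ} (h : I.IsSchedule s) {i j : Fin n}
    (hij : i ≠ j) (hadj : ¬ I.compat.Adj i j) :
    Apart (s i) (I.stretch i) (s j) (I.stretch j) := by
  have hi := I.stretch_pos_real i
  have hj := I.stretch_pos_real j
  have h1 := Set.disjoint_left.1 (h.compatible i j hij hadj)
  have h2 := Set.disjoint_left.1 (h.compatible j i hij.symm fun h' => hadj h'.symm)
  -- In every overlapping position one of the tasks starts during the idle time of the other; its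
  -- starting instant is the forbidden point.
  rcases h.fits hij with h' | ⟨h', h''⟩ | ⟨h', h''⟩ | ⟨h', h''⟩ | ⟨h', h''⟩
  · exact h'
  · exact (h2 (a := s j) (.inl ⟨by linarith, by linarith⟩) ⟨by linarith, by linarith⟩).elim
  · exact (h1 (a := s i) (.inl ⟨by linarith, by linarith⟩) ⟨by linarith, by linarith⟩).elim
  · exact (h2 (a := s j) (.inl ⟨by linarith, by linarith⟩) ⟨by linarith, by linarith⟩).elim
  · exact (h1 (a := s i) (.inl ⟨by linarith, by linarith⟩) ⟨by linarith, by linarith⟩).elim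

theorem isSchedule_of_fits {s : Fin n → ℝ} (h0 : ∀ i, 0 ≤ s i)
    (hfits : ∀ i j, i ≠ j → Fits (s i) (I.stretch i) (s j) (I.stretch j))
    (hapart : ∀ i j, i ≠ j → ¬ I.compat.Adj i j →
      Apart (s i) (I.stretch i) (s j) (I.stretch j)) : I.IsSchedule s where
  nonneg := h0
  machine i j hij := (I.disjoint_busy_iff s i j).2 (hfits i j hij)
  compatible i j hij hadj := I.disjoint_idle_of_apart (hapart i j hij hadj)

theorem le_makespan (s : Fin n → ℝ) (i : Fin n) : s i + 3 * I.stretch i ≤ I.makespan s :=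
  le_ciSup (f := fun i => s i + 3 * (I.stretch i : ℝ)) (Set.finite_range _).bddAbove i

theorem makespan_le {s : Fin n → ℝ} {M : ℝ} (hM : 0 ≤ M)
    (h : ∀ i, s i + 3 * I.stretch i ≤ M) : I.makespan s ≤ M :=
  Real.iSup_le h hM

end Instance

/-! ### Dynamic programming along the path -/

/-- `E k` is the minimum time for the tasks `k, k + 1, …` of a path with stretch factors `b`, and
`C k` tells how to begin: with task `k` alone (`0`), with `k` and `k + 1`, of which `k` (`1`) or
`k + 1` (`2`) starts first, or with `k`, `k + 1`, `k + 2`, of which `k + 1` starts first (`3`). The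
end of the path is marked by stretch factors `0`. -/
structure IsDPStep (b E C : ℕ → ℕ) (k : ℕ) : Prop where
  single : E k ≤ 3 * b k + E (k + 1)
  equal : 0 < b (k + 1) → b k = b (k + 1) → E k ≤ 4 * b k + E (k + 2)
  left : 0 < b (k + 1) → 3 * b (k + 1) ≤ b k → E k ≤ 3 * b k + E (k + 2)
  right : 0 < b (k + 1) → 3 * b k ≤ b (k + 1) → E k ≤ 3 * b (k + 1) + E (k + 2)
  both : 0 < b (k + 1) → 0 < b (k + 2) → 3 * b k + 3 * b (k + 2) ≤ b (k + 1) →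
    E k ≤ 3 * b (k + 1) + E (k + 3)
  attained : (C k = 0 ∧ E k = 3 * b k + E (k + 1)) ∨
    (C k = 1 ∧ 0 < b (k + 1) ∧ b k = b (k + 1) ∧ E k = 4 * b k + E (k + 2)) ∨
    (C k = 1 ∧ 0 < b (k + 1) ∧ 3 * b (k + 1) ≤ b k ∧ E k = 3 * b k + E (k + 2)) ∨
    (C k = 2 ∧ 0 < b (k + 1) ∧ 3 * b k ≤ b (k + 1) ∧ E k = 3 * b (k + 1) + E (k + 2)) ∨
    (C k = 3 ∧ 0 < b (k + 1) ∧ 0 < b (k + 2) ∧ 3 * b k + 3 * b (k + 2) ≤ b (k + 1) ∧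
      E k = 3 * b (k + 1) + E (k + 3))

/-! ### Lower bound by measuring occupied time -/

section LowerBound

variable {n : ℕ} {b : ℕ → ℕ} {t : ℕ → ℝ}

/-- The time occupied by the tasks `k, …, n - 1`. -/
def occupied (n : ℕ) (b : ℕ → ℕ) (t : ℕ → ℝ) (k : ℕ) : Set ℝ :=
  ⋃ j ∈ Set.Ico k n, Set.Ico (t j) (t j + 3 * b j)

theorem measurableSet_occupied (k : ℕ) : MeasurableSet (occupied n b t k) :=
  MeasurableSet.biUnion (Set.to_countable _) fun _ _ => measurableSet_Ico

/-- Peels off a block of `r` tasks: an interval covered by the tasks from `k` on and avoided by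
those from `k + r` on contributes its full length, by additivity of the measure. -/
theorem add_le_volume_occupied {k r ℓ e : ℕ} {p : ℝ} (he : (e : ENNReal) ≤ volume
      (occupied n b t (k + r)))
    (hsub : Set.Ico p (p + ℓ) ⊆ occupied n b t k)
    (hdisj : ∀ j, k + r ≤ j → j < n → p + ℓ ≤ t j ∨ t j + 3 * b j ≤ p) :
    ((ℓ + e : ℕ) : ENNReal) ≤ volume (occupied n b t k) := by
  have hd : Disjoint (Set.Ico p (p + ℓ)) (occupied n b t (k + r)) := by
    unfold occupied
    simp only [Set.disjoint_iUnion_right]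
    rintro j ⟨h1, h2⟩
    rw [Set.disjoint_left]
    rintro x ⟨h3, h4⟩ ⟨h5, h6⟩
    rcases hdisj j h1 h2 with h | h <;> linarith
  have hu : Set.Ico p (p + ℓ) ∪ occupied n b t (k + r) ⊆ occupied n b t k := by
    refine Set.union_subset hsub ?_
    unfold occupied
    exact Set.biUnion_subset_biUnion_left fun j hj => ⟨by have := hj.1; omega, hj.2⟩
  calc ((ℓ + e : ℕ) : ENNReal)
      ≤ volume (Set.Ico p (p + ℓ)) + volume (occupied n b t (k + r)) := by
        rw [Real.volume_Ico]
        push_cast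
        refine add_le_add ?_ he
        simp
    _ = volume (Set.Ico p (p + ℓ) ∪ occupied n b t (k + r)) :=
        (measure_union hd (measurableSet_occupied _)).symm
    _ ≤ _ := measure_mono hu

theorem subset_occupied {k j : ℕ} (h1 : k ≤ j) (h2 : j < n) :
    Set.Ico (t j) (t j + 3 * b j) ⊆ occupied n b t k :=
  Set.subset_biUnion_of_mem (u := fun j => Set.Ico (t j) (t j + 3 * (b j : ℝ)))
    (show j ∈ Set.Ico k n from ⟨h1, h2⟩)

/-- Induction on the number of remaining tasks. The position of `k` relative to `k + 1` determines
the block to peel off, and the matching inequality of the recurrence bounds `E k`. -/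
theorem le_volume_occupied {E C : ℕ → ℕ} (hb : ∀ j, 0 < b j ↔ j < n) (hE : E n = 0)
    (hstep : ∀ k < n, IsDPStep b E C k)
    (hapart : ∀ i j, i + 1 < j → j < n → Apart (t i) (b i) (t j) (b j))
    (hfits : ∀ i, i + 1 < n → Fits (t i) (b i) (t (i + 1)) (b (i + 1))) (d : ℕ) :
    ∀ k, k + d = n → (E k : ENNReal) ≤ volume (occupied n b t k) := by
  induction d using Nat.strong_induction_on with
  | _ d ih =>
  intro k hkd
  rcases Nat.eq_zero_or_pos d with rfl | hd
  · obtain rfl : k = n := by omega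
    simp [hE]
  have hk : k < n := by omega
  have H := hstep k hk
  have hx : (0 : ℝ) < b k := Nat.cast_pos.2 ((hb k).2 hk)
  have key : ∀ r ℓ : ℕ, ∀ p : ℝ, 0 < r → k + r ≤ n → E k ≤ ℓ + E (k + r) →
      Set.Ico p (p + ℓ) ⊆ occupied n b t k →
      (∀ j, k + r ≤ j → j < n → p + ℓ ≤ t j ∨ t j + 3 * b j ≤ p) →
      (E k : ENNReal) ≤ volume (occupied n b t k) := by
    intro r ℓ p hr hrn hle hsub hdisj
    refine le_trans ?_ (add_le_volume_occupied (ih (d - r) (by omega) (k + r) (by omega))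
      hsub hdisj)
    exact_mod_cast hle
  have hk1 : ((3 * b k : ℕ) : ℝ) = 3 * b k := by push_cast; ring
  have hk2 : ((3 * b (k + 1) : ℕ) : ℝ) = 3 * b (k + 1) := by push_cast; ring
  have hsub0 := subset_occupied (b := b) (t := t) le_rfl hk
  by_cases hk' : k + 1 < n
  swap
  · exact key 1 (3 * b k) (t k) one_pos (by omega) H.single (by rw [hk1]; exact hsub0)
      (fun j hj hjn => by omega)
  have hy : (0 : ℝ) < b (k + 1) := Nat.cast_pos.2 ((hb (k + 1)).2 hk')
  have hsub1 := subset_occupied (b := b) (t := t) (Nat.le_succ k) hk'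
  have hA0 : ∀ j, k + 2 ≤ j → j < n → Apart (t k) (b k) (t j) (b j) :=
    fun j hj hjn => hapart k j (by omega) hjn
  have hA1 : ∀ j, k + 3 ≤ j → j < n → Apart (t (k + 1)) (b (k + 1)) (t j) (b j) :=
    fun j hj hjn => hapart (k + 1) j (by omega) hjn
  -- If `k` is not apart from `k + 1`, then `k + 2` is apart from `k + 1` or inside it.
  have hnext : ¬ Apart (t k) (b k : ℝ) (t (k + 1)) (b (k + 1)) → k + 2 < n →
      Apart (t (k + 1)) (b (k + 1) : ℝ) (t (k + 2)) (b (k + 2)) ∨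
      (Inside (t (k + 2)) (b (k + 2) : ℝ) (t (k + 1)) (b (k + 1)) ∧
        Inside (t k) (b k : ℝ) (t (k + 1)) (b (k + 1))) := by
    intro hna hk''
    have hz : (0 : ℝ) < b (k + 2) := Nat.cast_pos.2 ((hb (k + 2)).2 hk'')
    have h1 := hA0 (k + 2) le_rfl hk''
    have h2 := hfits (k + 1) hk''
    have h3 := hfits k hk'
    simp only [Nat.add_assoc, Nat.reduceAdd] at h2
    generalize (b k : ℝ) = x at *
    generalize (b (k + 1) : ℝ) = y at *
    generalize (b (k + 2) : ℝ) = z at *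
    generalize t k = p at *
    generalize t (k + 1) = q at *
    generalize t (k + 2) = w at *
    by_cases h4 : Apart q y w z
    · exact .inl h4
    right
    unfold Fits Apart Inside Interleaved at *
    push Not at hna h4
    obtain ⟨n1, n2⟩ := hna
    obtain ⟨n3, n4⟩ := h4
    -- Whatever overlaps `k + 1` meets its idle time, and covers this idle time unless nested inside
    -- it. As `k` and `k + 2` are apart, both must be nested.
    rcases h2 with (h2 | h2) | ⟨h2, h2'⟩ | ⟨h2, h2'⟩ | ⟨h2, h2'⟩ | ⟨h2, h2'⟩ <;>
    rcases h3 with (h3 | h3) | ⟨h3, h3'⟩ | ⟨h3, h3'⟩ | ⟨h3, h3'⟩ | ⟨h3, h3'⟩ <;>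
    rcases h1 with h1 | h1 <;>
    first
      | (exfalso; linarith)
      | exact ⟨⟨by linarith, by linarith⟩, by linarith, by linarith⟩
  rcases hfits k hk' with h | ⟨h, h'⟩ | ⟨h, h'⟩ | ⟨h, h'⟩ | ⟨h, h'⟩
  · refine key 1 (3 * b k) (t k) one_pos (by omega) H.single (by rw [hk1]; exact hsub0) ?_
    intro j hj hjn
    rw [hk1]
    rcases hj.eq_or_lt with rfl | hj
    · exact h
    · exact hA0 j hj hjn
  · refine key 2 (3 * b k) (t k) two_pos (by omega) (H.left ((hb _).2 hk') ?_)
      (by rw [hk1]; exact hsub0) ?_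
    · have : (3 * b (k + 1) : ℝ) ≤ b k := by linarith
      exact_mod_cast this
    · intro j hj hjn
      rw [hk1]
      exact hA0 j hj hjn
  · have hna : ¬ Apart (t k) (b k : ℝ) (t (k + 1)) (b (k + 1)) := by
      unfold Apart; push Not; constructor <;> linarith
    have hxy : 3 * b k ≤ b (k + 1) := by
      have : (3 * b k : ℝ) ≤ b (k + 1) := by linarith
      exact_mod_cast this
    -- With `k` inside `k + 1`, the block has three tasks exactly when `k + 2` overlaps `k + 1` too;
    -- then `k` and `k + 2` share one idle time side by side.
    by_cases hz : k + 2 < n ∧ ¬ Apart (t (k + 1)) (b (k + 1) : ℝ) (t (k + 2)) (b (k + 2))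
    · obtain ⟨hin, -⟩ := (hnext hna hz.1).resolve_left hz.2
      refine key 3 (3 * b (k + 1)) (t (k + 1)) three_pos (by omega)
        (H.both ((hb _).2 hk') ((hb _).2 hz.1) ?_) (by rw [hk2]; exact hsub1) ?_
      · have hz' : (0 : ℝ) < b (k + 2) := Nat.cast_pos.2 ((hb (k + 2)).2 hz.1)
        have : (3 * b k + 3 * b (k + 2) : ℝ) ≤ b (k + 1) := by
          obtain ⟨h3, h4⟩ := hin
          rcases hA0 (k + 2) le_rfl hz.1 with h5 | h5 <;> linarith
        exact_mod_cast this
      · intro j hj hjn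
        rw [hk2]
        exact hA1 j hj hjn
    · refine key 2 (3 * b (k + 1)) (t (k + 1)) two_pos (by omega)
        (H.right ((hb _).2 hk') hxy) (by rw [hk2]; exact hsub1) ?_
      intro j hj hjn
      rw [hk2]
      rcases hj.eq_or_lt with rfl | hj
      · exact not_not.1 fun h6 => hz ⟨hjn, h6⟩
      · exact hA1 j hj hjn
  all_goals
    have hna : ¬ Apart (t k) (b k : ℝ) (t (k + 1)) (b (k + 1)) := by
      unfold Apart; push Not; constructor <;> linarith
    have hxy : b k = b (k + 1) := by
      first
        | exact_mod_cast h
        | exact_mod_cast h.symm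
    have hk4 : ((4 * b k : ℕ) : ℝ) = 4 * b k := by push_cast; ring
    have hA1' : ∀ j, k + 2 ≤ j → j < n → Apart (t (k + 1)) (b (k + 1)) (t j) (b j) := by
      intro j hj hjn
      rcases hj.eq_or_lt with rfl | hj
      · refine (hnext hna hjn).resolve_right ?_
        rintro ⟨-, h3, h4⟩
        linarith
      · exact hA1 j hj hjn
  · refine key 2 (4 * b k) (t k) two_pos (by omega) (H.equal ((hb _).2 hk') hxy) ?_ ?_
    · rw [hk4]
      rintro u ⟨hu, hu'⟩
      rcases lt_or_ge u (t k + 3 * b k) with h3 | h3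
      · exact hsub0 ⟨hu, h3⟩
      · exact hsub1 ⟨by linarith, by linarith⟩
    · intro j hj hjn
      have hw := (hb j).2 hjn
      have hw' : (0 : ℝ) < b j := Nat.cast_pos.2 hw
      rw [hk4]
      -- The intervals of the interleaved pair overlap, so no later task fits between them: it
      -- avoids their whole union, of length `4 * b k`.
      rcases hA0 j hj hjn with h3 | h3 <;> rcases hA1' j hj hjn with h4 | h4
      · left; linarith
      · exfalso; linarith
      · right; linarith
      · right; linarith
  · refine key 2 (4 * b k) (t (k + 1)) two_pos (by omega) (H.equal ((hb _).2 hk') hxy) ?_ ?_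
    · rw [hk4]
      rintro u ⟨hu, hu'⟩
      rcases lt_or_ge u (t (k + 1) + 3 * b (k + 1)) with h3 | h3
      · exact hsub1 ⟨hu, h3⟩
      · exact hsub0 ⟨by linarith, by linarith⟩
    · intro j hj hjn
      have hw := (hb j).2 hjn
      have hw' : (0 : ℝ) < b j := Nat.cast_pos.2 hw
      rw [hk4]
      rcases hA0 j hj hjn with h3 | h3 <;> rcases hA1' j hj hjn with h4 | h4
      · left; linarith
      · exfalso; linarith
      · right; linarith
      · right; linarith

end LowerBound

/-! ### Building a schedule from the recurrence -/

/-- The tasks before `k` have been given starting times `s`, and are finished at `E 0 - E k`. -/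
structure Placed (n : ℕ) (b E s : ℕ → ℕ) (k : ℕ) : Prop where
  le : k ≤ n
  cost_le : E k ≤ E 0
  finished : ∀ j < k, s j + 3 * b j ≤ E 0 - E k
  apart : ∀ i j, i + 1 < j → j < k → Apart (s i) (b i) (s j) (b j)
  fits : ∀ i, i + 1 < k → Fits (s i) (b i) (s (i + 1)) (b (i + 1))

theorem Placed.zero (n : ℕ) (b E s : ℕ → ℕ) : Placed n b E s 0 :=
  ⟨Nat.zero_le _, le_rfl, by omega, by omega, by omega⟩

/-- The new block stays in the window from `E 0 - E k` to `E 0 - E (k + r)`. The old tasks end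
before it, so only pairs inside the block need checking. -/
theorem Placed.extend {n : ℕ} {b E s s' : ℕ → ℕ} {k r : ℕ} (h : Placed n b E s k)
    (hr : k + r ≤ n) (hE : E (k + r) ≤ E k) (hold : ∀ j < k, s' j = s j)
    (hnew : ∀ j, k ≤ j → j < k + r → E 0 - E k ≤ s' j ∧ s' j + 3 * b j ≤ E 0 - E (k + r))
    (hapart : ∀ i j, k ≤ i → i + 1 < j → j < k + r → Apart (s' i) (b i) (s' j) (b j))
    (hfits : ∀ i, k ≤ i → i + 1 < k + r → Fits (s' i) (b i) (s' (i + 1)) (b (i + 1))) :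
    Placed n b E s' (k + r) where
  le := hr
  cost_le := hE.trans h.cost_le
  finished j hj := by
    rcases lt_or_ge j k with hjk | hjk
    · rw [hold j hjk]
      have := h.finished j hjk
      omega
    · exact (hnew j hjk hj).2
  apart i j hij hj := by
    rcases lt_or_ge i k with hik | hik
    · rcases lt_or_ge j k with hjk | hjk
      · rw [hold i hik, hold j hjk]
        exact h.apart i j hij hjk
      · rw [hold i hik]
        exact .inl ((h.finished i hik).trans (hnew j hjk hj).1)
    · exact hapart i j hik hij hj
  fits i hi := by
    rcases lt_or_ge i k with hik | hik
    · rcases lt_or_ge (i + 1) k with hjk | hjk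
      · rw [hold i hik, hold _ hjk]
        exact h.fits i hjk
      · rw [hold i hik]
        exact .inl (.inl ((h.finished i hik).trans (hnew _ hjk hi).1))
    · exact hfits i hik hi

theorem Placed.extend_one {n : ℕ} {b E s s' : ℕ → ℕ} {k : ℕ} (h : Placed n b E s k)
    (hr : k + 1 ≤ n) (hE : E k = 3 * b k + E (k + 1)) (hold : ∀ j < k, s' j = s j)
    (h0 : s' k = E 0 - E k) : Placed n b E s' (k + 1) := by
  have := h.cost_le
  refine h.extend hr (by omega) hold ?_ (by omega) (by omega)
  intro j h1 h2
  obtain rfl : j = k := by omega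
  omega

theorem Placed.extend_two {n : ℕ} {b E s s' : ℕ → ℕ} {k : ℕ} (h : Placed n b E s k)
    (hr : k + 2 ≤ n) (hE : E (k + 2) ≤ E k) (hold : ∀ j < k, s' j = s j)
    (h0 : E 0 - E k ≤ s' k ∧ s' k + 3 * b k ≤ E 0 - E (k + 2))
    (h1 : E 0 - E k ≤ s' (k + 1) ∧ s' (k + 1) + 3 * b (k + 1) ≤ E 0 - E (k + 2))
    (hfits : Fits (s' k) (b k) (s' (k + 1)) (b (k + 1))) : Placed n b E s' (k + 2) := by
  refine h.extend hr hE hold ?_ (by omega) ?_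
  · intro j h2 h3
    obtain rfl | rfl : j = k ∨ j = k + 1 := by omega
    exacts [h0, h1]
  · intro i h2 h3
    obtain rfl : i = k := by omega
    exact hfits

theorem Placed.extend_three {n : ℕ} {b E s s' : ℕ → ℕ} {k : ℕ} (h : Placed n b E s k)
    (hr : k + 3 ≤ n) (hE : E k = 3 * b (k + 1) + E (k + 3))
    (hb : 3 * b k + 3 * b (k + 2) ≤ b (k + 1)) (hold : ∀ j < k, s' j = s j)
    (h0 : s' k = E 0 - E k + b (k + 1)) (h1 : s' (k + 1) = E 0 - E k)
    (h2 : s' (k + 2) = E 0 - E k + b (k + 1) + 3 * b k) : Placed n b E s' (k + 3) := by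
  have := h.cost_le
  refine h.extend hr (by omega) hold ?_ ?_ ?_
  · intro j h3 h4
    obtain rfl | rfl | rfl : j = k ∨ j = k + 1 ∨ j = k + 2 := by omega
    all_goals omega
  · intro i j h3 h4 h5
    obtain ⟨rfl, rfl⟩ : i = k ∧ j = k + 2 := by omega
    unfold Apart
    omega
  · intro i h3 h4
    obtain rfl | rfl : i = k ∨ i = k + 1 := by omega
    · unfold Fits Inside
      omega
    · simp only [Nat.add_assoc, Nat.reduceAdd]
      unfold Fits Inside
      omega

end CoupledTasks

namespace CoupledTasks

/-! ### The input in memory and the order along the path -/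

namespace Instance

variable {n : ℕ} (I : Instance n)

theorem inputMem_of_lt {a : ℕ} (h : a < n) : I.inputMem a = I.stretch ⟨a, h⟩ := by
  simp [inputMem, h]

theorem inputMem_le_one {a : ℕ} (h : n ≤ a) : I.inputMem a ≤ 1 := by
  unfold inputMem
  rw [dif_neg (by omega)]
  split_ifs <;> omega

theorem inputMem_of_ge {a : ℕ} (h : n + n * n ≤ a) : I.inputMem a = 0 := by
  unfold inputMem
  rw [dif_neg (by nlinarith), if_neg]
  rintro ⟨i, j, h1, -⟩
  have hi := i.2
  have hj := j.2
  have : (i + 1) * n ≤ n * n := Nat.mul_le_mul_right n hi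
  rw [add_mul] at this
  omega

-- Since `j < n`, division by `n` recovers `i` and `j` from `i * n + j`, so distinct entries occupy
-- distinct cells.
open Classical in
theorem inputMem_adj (i j : Fin n) :
    I.inputMem (n + i * n + j) = if I.compat.Adj i j then 1 else 0 := by
  unfold inputMem
  rw [dif_neg (by omega)]
  refine if_congr ⟨?_, fun h => ⟨i, j, rfl, h⟩⟩ rfl rfl
  rintro ⟨i', j', h, h'⟩
  have hn : 0 < n := by have := i.2; omega
  have h1 : (i : ℕ) * n + j = i' * n + j' := by omega
  have h2 : (i : ℕ) = i' := by
    have := congrArg (· / n) h1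
    simpa [Nat.mul_comm _ n, Nat.mul_add_div hn, Nat.div_eq_of_lt] using this
  have h3 : (j : ℕ) = j' := by rw [h2] at h1; omega
  rwa [Fin.ext h2, Fin.ext h3]

theorem size_inputMem_le (a : ℕ) : (I.inputMem a).size ≤ I.inputLength + 1 := by
  unfold inputLength
  rcases lt_or_ge a n with h | h
  · rw [I.inputMem_of_lt h]
    have := Finset.single_le_sum (f := fun i => (I.stretch i).size) (fun _ _ => Nat.zero_le _)
      (Finset.mem_univ ⟨a, h⟩)
    omega
  · have := Nat.size_le_size (I.inputMem_le_one h)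
    rw [Nat.size_one] at this
    omega

/-- `f` lists the tasks in their order along the path. -/
def IsOrder (f : Fin n ≃ Fin n) : Prop :=
  ∀ i j, I.compat.Adj (f i) (f j) ↔ (i : ℕ) + 1 = j ∨ (j : ℕ) + 1 = i

variable {I}

theorem IsChain.exists_isOrder (h : I.IsChain) : ∃ f, I.IsOrder f := by
  obtain ⟨φ⟩ := h
  refine ⟨φ.toEquiv, fun i j => ?_⟩
  have := φ.map_rel_iff (a := i) (b := j)
  rw [SimpleGraph.pathGraph_adj] at this
  exact this

theorem IsOrder.rev {f : Fin n ≃ Fin n} (h : I.IsOrder f) :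
    I.IsOrder ((Fin.revPerm).trans f) := by
  intro i j
  have := h (Fin.rev i) (Fin.rev j)
  simp only [Equiv.trans_apply, Fin.revPerm_apply]
  rw [this]
  simp only [Fin.val_rev]
  omega

/-- The task at position `k` of the path. -/
def taskAt (f : Fin n ≃ Fin n) (k : ℕ) : ℕ := if h : k < n then f ⟨k, h⟩ else 0

theorem taskAt_lt {f : Fin n ≃ Fin n} {k : ℕ} (h : k < n) : taskAt f k < n := by
  simp [taskAt, h]

theorem taskAt_fin (f : Fin n ≃ Fin n) (k : Fin n) : taskAt f k = f k := by
  simp [taskAt]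

theorem taskAt_inj {f : Fin n ≃ Fin n} {i j : ℕ} (hi : i < n) (hj : j < n) :
    taskAt f i = taskAt f j ↔ i = j := by
  simp [taskAt, hi, hj, Fin.val_inj]

open Classical in
/-- A sum over the neighbours of a task. -/
theorem IsOrder.sum_adj {f : Fin n ≃ Fin n} (h : I.IsOrder f) (g : ℕ → ℕ) {k : ℕ} (hk : k < n) :
    ∑ j ∈ Finset.range n, I.inputMem (n + taskAt f k * n + j) * g j =
      (if 0 < k then g (taskAt f (k - 1)) else 0) +
        (if k + 1 < n then g (taskAt f (k + 1)) else 0) := by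
  -- The two possible neighbours sit at distinct positions, so the indicator of adjacency is a sum
  -- of two indicators. The condition `0 < k` guards against truncation in `k - 1`.
  have h1 : ∀ i ∈ Finset.range n,
      (if k + 1 = i ∨ i + 1 = k then 1 else 0) * g (taskAt f i) =
        (if k + 1 = i then g (taskAt f i) else 0) +
        (if 0 < k ∧ k - 1 = i then g (taskAt f i) else 0) := by
    intro i _
    by_cases h2 : k + 1 = i
    · have : ¬ (0 < k ∧ k - 1 = i) := by omega
      simp [h2, this]
    · by_cases h3 : 0 < k ∧ k - 1 = i
      · have : i + 1 = k := by omega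
        simp [h2, h3, this]
      · have : ¬ (i + 1 = k) := by omega
        simp [h2, h3, this]
  calc ∑ j ∈ Finset.range n, I.inputMem (n + taskAt f k * n + j) * g j
      = ∑ j : Fin n, I.inputMem (n + taskAt f k * n + j) * g j := Finset.sum_range _
    _ = ∑ i : Fin n, I.inputMem (n + taskAt f k * n + f i) * g (f i) :=
        (Equiv.sum_comp f fun j : Fin n => I.inputMem (n + taskAt f k * n + j) * g j).symm
    _ = ∑ i : Fin n, (if k + 1 = (i : ℕ) ∨ (i : ℕ) + 1 = k then 1 else 0) * g (taskAt f i) := by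
        refine Finset.sum_congr rfl fun i _ => ?_
        have h2 := taskAt_fin f ⟨k, hk⟩
        simp only at h2
        rw [h2, I.inputMem_adj, taskAt_fin]
        congr 1
        exact if_congr (h _ _) rfl rfl
    _ = ∑ i ∈ Finset.range n, (if k + 1 = i ∨ i + 1 = k then 1 else 0) * g (taskAt f i) :=
        (Finset.sum_range fun i =>
          (if k + 1 = i ∨ i + 1 = k then 1 else 0) * g (taskAt f i)).symm
    _ = _ := by
        rw [Finset.sum_congr rfl h1, Finset.sum_add_distrib, Finset.sum_ite_eq, add_comm]
        congr 1
        · by_cases h2 : 0 < k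
          · simp only [h2, true_and, if_true]
            rw [Finset.sum_ite_eq, if_pos (Finset.mem_range.2 (by omega))]
          · simp [h2]
        · simp [Finset.mem_range]

/-- The sum of `g` over the neighbours of task `i`, as read from the memory. -/
noncomputable def neighbourSum (I : Instance n) (g : ℕ → ℕ) (i : ℕ) : ℕ :=
  ∑ j ∈ Finset.range n, I.inputMem (n + i * n + j) * g j

/-- A task with at most one neighbour is an end of the path. -/
theorem IsChain.exists_isOrder_from (h : I.IsChain) {i : ℕ} (hi : i < n)
    (hdeg : I.neighbourSum (fun _ => 1) i < 2) : ∃ f, I.IsOrder f ∧ taskAt f 0 = i := by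
  obtain ⟨f, hf⟩ := h.exists_isOrder
  obtain ⟨k, hk⟩ := f.surjective ⟨i, hi⟩
  have hki : taskAt f k = i := by rw [taskAt_fin, hk]
  have h2 := hf.sum_adj (fun _ => 1) k.2
  unfold neighbourSum at hdeg
  rw [hki] at h2
  rw [h2] at hdeg
  have hkn := k.2
  -- An inner position has degree two. If the task is at the last position, the path is read
  -- backwards.
  have h3 : (k : ℕ) = 0 ∨ (k : ℕ) + 1 = n := by
    by_contra hcon
    push Not at hcon
    rw [if_pos (by omega), if_pos (by omega)] at hdeg
    omega
  rcases h3 with h3 | h3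
  · exact ⟨f, hf, by rw [← h3, hki]⟩
  · refine ⟨_, hf.rev, ?_⟩
    have hn : 0 < n := by omega
    have h4 : Fin.rev ⟨0, hn⟩ = k := by
      apply Fin.ext
      simp only [Fin.val_rev]
      omega
    rw [taskAt, dif_pos hn, Equiv.trans_apply, Fin.revPerm_apply, h4, hk]

theorem IsChain.exists_end (h : I.IsChain) (hn : 0 < n) :
    ∃ i < n, I.neighbourSum (fun _ => 1) i < 2 := by
  obtain ⟨f, hf⟩ := h.exists_isOrder
  refine ⟨taskAt f 0, taskAt_lt hn, ?_⟩
  unfold neighbourSum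
  rw [hf.sum_adj _ hn]
  split_ifs <;> omega

/-- The stretch factor at position `k` of the path, `0` beyond the end. -/
noncomputable def stretchAt (I : Instance n) (f : Fin n ≃ Fin n) (k : ℕ) : ℕ :=
  if k < n then I.inputMem (taskAt f k) else 0

theorem stretchAt_fin (f : Fin n ≃ Fin n) (k : Fin n) : I.stretchAt f k = I.stretch (f k) := by
  rw [stretchAt, if_pos k.2, I.inputMem_of_lt (taskAt_lt k.2)]
  congr 1
  exact Fin.ext (taskAt_fin f k)

/-- Makes the stretch factor `0` a valid end mark, so that the recurrence needs no test against `n`.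
-/
theorem stretchAt_pos_iff (f : Fin n ≃ Fin n) (k : ℕ) : 0 < I.stretchAt f k ↔ k < n := by
  by_cases h : k < n
  · have := stretchAt_fin (I := I) f ⟨k, h⟩
    simp only at this
    rw [this]
    exact ⟨fun _ => h, fun _ => I.stretch_pos _⟩
  · simp [stretchAt, h]

/-- The occupied time has measure at least `E 0` and lies in an interval whose length is the
makespan. -/
theorem IsOrder.le_makespan {f : Fin n ≃ Fin n} (hf : I.IsOrder f) {E C : ℕ → ℕ}
    (hE : E n = 0) (hstep : ∀ k < n, IsDPStep (I.stretchAt f) E C k) {s : Fin n → ℝ}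
    (hs : I.IsSchedule s) : (E 0 : ℝ) ≤ I.makespan s := by
  set t : ℕ → ℝ := fun k => if h : k < n then s (f ⟨k, h⟩) else 0 with ht
  have ht' : ∀ k : Fin n, t k = s (f k) := fun k => by simp [ht]
  have hM : 0 ≤ I.makespan s :=
    Real.iSup_nonneg fun i => add_nonneg (hs.nonneg i) (by positivity)
  have h1 := le_volume_occupied (t := t) (stretchAt_pos_iff (I := I) f) hE hstep ?_ ?_ n 0
    (by omega)
  · have h2 : occupied n (I.stretchAt f) t 0 ⊆ Set.Ico 0 (0 + I.makespan s) := by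
      unfold occupied
      refine Set.iUnion₂_subset fun j hj => ?_
      have h3 := ht' ⟨j, hj.2⟩
      have h4 := stretchAt_fin (I := I) f ⟨j, hj.2⟩
      simp only at h3 h4
      rw [h3, h4]
      rintro x ⟨h5, h6⟩
      exact ⟨(hs.nonneg _).trans h5, by have := I.le_makespan s (f ⟨j, hj.2⟩); linarith⟩
    have h3 := h1.trans (MeasureTheory.measure_mono h2)
    rw [Real.volume_Ico, ← ENNReal.ofReal_natCast,
      ENNReal.ofReal_le_ofReal_iff (by linarith)] at h3
    linarith
  · intro i j hij hj
    have hi : i < n := by omega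
    have h5 := hs.apart (i := f ⟨i, hi⟩) (j := f ⟨j, hj⟩)
      (by simp only [ne_eq, EmbeddingLike.apply_eq_iff_eq, Fin.mk.injEq]; omega)
      (by rw [hf]; simp only; omega)
    rw [← ht', ← ht', ← stretchAt_fin, ← stretchAt_fin] at h5
    exact h5
  · intro i hj
    have hi : i < n := by omega
    have h5 := hs.fits (i := f ⟨i, hi⟩) (j := f ⟨i + 1, hj⟩)
      (by simp only [ne_eq, EmbeddingLike.apply_eq_iff_eq, Fin.mk.injEq]; omega)
    rw [← ht', ← ht', ← stretchAt_fin, ← stretchAt_fin] at h5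
    exact h5

/-- A schedule that has been built along the path is optimal. -/
theorem IsOrder.isOptimal {f : Fin n ≃ Fin n} (hf : I.IsOrder f) {E C : ℕ → ℕ}
    (hE : E n = 0) (hstep : ∀ k < n, IsDPStep (I.stretchAt f) E C k) {m : ℕ → ℕ}
    (hm : Placed n (I.stretchAt f) E (fun k => m (taskAt f k)) n) :
    I.IsOptimal (fun i => (m i : ℝ)) ∧ I.makespan (fun i => (m i : ℝ)) = E 0 := by
  have hsched : I.IsSchedule (fun i => (m i : ℝ)) := by
    have hall : ∀ i j : Fin n, i < j →
        Fits (m (f i) : ℝ) (I.stretch (f i)) (m (f j)) (I.stretch (f j)) ∧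
        (¬ I.compat.Adj (f i) (f j) →
          Apart (m (f i) : ℝ) (I.stretch (f i)) (m (f j)) (I.stretch (f j))) := by
      intro i j hij
      have hij' : (i : ℕ) < j := hij
      rcases Nat.lt_or_ge (i + 1 : ℕ) j with h | h
      · have h1 := (hm.apart i j h j.2).cast
        rw [taskAt_fin, taskAt_fin, stretchAt_fin, stretchAt_fin] at h1
        exact ⟨.inl h1, fun _ => h1⟩
      · have hj : (i : ℕ) + 1 = j := by omega
        refine ⟨?_, fun hna => (hna ((hf i j).2 (.inl hj))).elim⟩
        have h1 := (hm.fits i (by omega)).cast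
        simp only [hj] at h1
        rw [taskAt_fin, taskAt_fin, stretchAt_fin, stretchAt_fin] at h1
        exact h1
    refine I.isSchedule_of_fits (fun i => Nat.cast_nonneg _) ?_ ?_
    · intro i j hij
      obtain ⟨i, rfl⟩ := f.surjective i
      obtain ⟨j, rfl⟩ := f.surjective j
      rcases lt_or_gt_of_ne (fun h => hij (congrArg f h)) with h | h
      · exact (hall i j h).1
      · exact (hall j i h).1.symm
    · intro i j hij hna
      obtain ⟨i, rfl⟩ := f.surjective i
      obtain ⟨j, rfl⟩ := f.surjective j
      rcases lt_or_gt_of_ne (fun h => hij (congrArg f h)) with h | h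
      · exact (hall i j h).2 hna
      · exact ((hall j i h).2 fun h' => hna h'.symm).symm
  have hle : I.makespan (fun i => (m i : ℝ)) ≤ E 0 := by
    refine makespan_le I (Nat.cast_nonneg _) fun i => ?_
    obtain ⟨i, rfl⟩ := f.surjective i
    have h1 := hm.finished i i.2
    rw [taskAt_fin, stretchAt_fin, hE] at h1
    exact_mod_cast h1
  exact ⟨⟨hsched, fun s' hs' => hle.trans (hf.le_makespan hE hstep hs')⟩,
    le_antisymm hle (hf.le_makespan hE hstep hsched)⟩

end Instance

end CoupledTasks

namespace RAM

/-- A sequence of programs. -/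
def block : List Program → Program
  | [] => .skip
  | p :: ps => .seq p (block ps)

/-- A loop with an invariant and a measure that bounds the number of rounds. -/
theorem Ends.while_measure {x y : ℕ} {p : Program} {T : ℕ} (Inv : State → Prop) (μ : State → ℕ)
    (body : ∀ s, Inv s → s.reg x < s.reg y → Ends p s T (fun s' => Inv s' ∧ μ s' < μ s))
    {s : State} {M : ℕ} (h : Inv s) (hM : μ s ≤ M) :
    Ends (.whileLt x y p) s (M * (T + 1) + 1) (fun s' => Inv s' ∧ ¬ s'.reg x < s'.reg y) := by
  refine (Ends.while (T := T) (fun m s => μ s = m ∧ Inv s) ?_ (μ s) s ⟨rfl, h⟩).mono ?_ ?_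
  · rintro m s ⟨rfl, hs⟩ hlt
    exact (body s hs hlt).mono le_rfl fun s' hs' => ⟨_, hs'.2, rfl, hs'.1⟩
  · have := Nat.mul_le_mul_right (T + 1) hM
    omega
  · rintro s' ⟨⟨m, -, h1⟩, h2⟩
    exact ⟨h1, h2⟩

end RAM

namespace CoupledTasks

open RAM Program

/-- The first memory cell beyond the input. -/
def base (n : ℕ) : ℕ := n + n * n

/-- Registers that keep their values after the initialization: the number of tasks, small constants
and the beginnings of the arrays. -/
def Fixed (n : ℕ) (s : State) : Prop :=
  s.reg 0 = n ∧ s.reg 1 = 1 ∧ s.reg 2 = 0 ∧ s.reg 3 = 2 ∧ s.reg 4 = 3 ∧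
  s.reg 5 = base n ∧ s.reg 6 = base n + (n + 3) ∧ s.reg 7 = base n + 2 * (n + 3) ∧
  s.reg 8 = base n + 3 * (n + 3) ∧ s.reg 9 = base n + 4 * (n + 3)

/-! ### Initialization -/

/-- Register `2` keeps its initial value `0`, so `add x y 2` copies `y` to `x`. -/
def initConsts : Program := block [const 1 1, const 3 2, const 4 3, add 5 0 2]

/-- Without multiplication, `n * n` is obtained by `n` additions. -/
def squareBody : Program := block [add 5 5 0, add 10 10 1]

/-- Beyond the input lie five arrays: neighbour sums, path order, stretch factors along the path,
values, choices. They are `n + 3` cells apart because the recurrence reads up to three positions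
ahead. -/
def initBases : Program :=
  block [add 17 0 4, add 6 5 17, add 7 6 17, add 8 7 17, add 9 8 17, const 10 0, add 12 0 2]

def initProgram : Program := .seq initConsts (.seq (.whileLt 10 0 squareBody) initBases)

variable {n : ℕ} (I : Instance n)

theorem initProgram_ends :
    Ends initProgram I.input (n * 4 + 14)
      (fun s => Fixed n s ∧ s.reg 10 = 0 ∧ s.reg 12 = n ∧ s.reg 15 = 0 ∧ s.mem = I.inputMem) := by
  let J : State → Prop := fun s => s.reg 0 = n ∧ s.reg 1 = 1 ∧ s.reg 2 = 0 ∧ s.reg 3 = 2 ∧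
    s.reg 4 = 3 ∧ s.reg 5 = n + s.reg 10 * n ∧ s.reg 10 ≤ n ∧ s.reg 15 = 0 ∧ s.mem = I.inputMem
  have h1 : Ends initConsts I.input 5 (fun s => J s ∧ s.reg 10 = 0) := by
    refine (Ends.of_wp (P := initConsts) ?_).mono le_rfl fun s h => h
    simp [initConsts, block, wp, J, Instance.input, State.setReg]
  have h2 : ∀ s, J s → Ends (.whileLt 10 0 squareBody) s (n * 4 + 1)
      (fun s => J s ∧ s.reg 10 = n) := by
    intro s hs
    refine (Ends.while_measure (T := 3) (M := n) J (fun s => n - s.reg 10) ?_ hs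
      (Nat.sub_le _ _)).mono le_rfl ?_
    · rintro s ⟨h0, h1, h2, h3, h4, h5, h10, h15, hm⟩ hlt
      refine (Ends.of_wp (P := squareBody) ?_).mono le_rfl fun s h => h
      rw [h0] at hlt
      simp [squareBody, block, wp, J, h0, h1, h2, h3, h4, h5, h15]
      refine ⟨⟨by ring, by omega, hm⟩, by omega⟩
    · rintro s ⟨hs, hlt⟩
      refine ⟨hs, ?_⟩
      obtain ⟨h0, -, -, -, -, -, h10, -⟩ := hs
      omega
  refine (h1.seq fun s hs => (h2 s hs.1).seq fun s' hs' =>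
    Ends.of_wp (P := initBases) ?_).mono (T := 5 + (n * 4 + 1 + 8)) (by omega) fun s h => h
  obtain ⟨⟨h0, h1, h2, h3, h4, h5, h10, h15, hm⟩, h10'⟩ := hs'
  simp [initBases, block, wp, Fixed, h0, h1, h2, h3, h4, h5, h15, h10', base]
  exact ⟨⟨by ring, by ring, by ring⟩, hm⟩

/-! ### Sums over the neighbours, and an end of the path -/

def scanInit : Program := block [const 11 0, const 13 0, const 14 0]

/-- Register `13` accumulates the labels of the neighbours and register `14` their number. -/
def scanBody : Program :=
  block [load 18 12, ifLt 2 18 (block [add 13 13 11, add 14 14 1]) skip, add 12 12 1, add 11 11 1]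

def scanEnd : Program :=
  block [add 17 5 10, store 17 13, ifLt 14 3 (add 15 10 2) skip, add 10 10 1]

def scanRow : Program := .seq scanInit (.seq (.whileLt 11 0 scanBody) scanEnd)

def scanProgram : Program := .whileLt 10 0 scanRow

/-- The first `s.reg 10` rows of the adjacency matrix have been processed. -/
structure ScanInv (s : State) : Prop where
  fixed : Fixed n s
  le : s.reg 10 ≤ n
  pointer : s.reg 12 = n + s.reg 10 * n
  input : ∀ a < base n, s.mem a = I.inputMem a
  sums : ∀ j < s.reg 10, s.mem (base n + j) = I.neighbourSum (fun j => j) j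
  zero : ∀ a, base n + n ≤ a → s.mem a = 0
  start : ∀ j < s.reg 10, I.neighbourSum (fun _ => 1) j < 2 →
    s.reg 15 < n ∧ I.neighbourSum (fun _ => 1) (s.reg 15) < 2

/-- The first `s.reg 11` entries of a row have been read since state `s₀`. -/
structure ScanRowInv (s₀ s : State) : Prop where
  fixed : Fixed n s
  le : s.reg 11 ≤ n
  row : s.reg 10 = s₀.reg 10
  start : s.reg 15 = s₀.reg 15
  mem : s.mem = s₀.mem
  pointer : s.reg 12 = n + s.reg 10 * n + s.reg 11
  sum : s.reg 13 = ∑ j ∈ Finset.range (s.reg 11), I.inputMem (n + s.reg 10 * n + j) * j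
  degree : s.reg 14 = ∑ j ∈ Finset.range (s.reg 11), I.inputMem (n + s.reg 10 * n + j) * 1

variable {I}

theorem scanBody_wp {s₀ s : State} (hs₀ : ScanInv I s₀) (hlt₀ : s₀.reg 10 < n)
    (hs : ScanRowInv I s₀ s) (hlt : s.reg 11 < n) :
    wp scanBody s (fun s' => ScanRowInv I s₀ s' ∧ n - s'.reg 11 < n - s.reg 11) := by
  obtain ⟨⟨f0, f1, f2, f3, f4, f5, f6, f7, f8, f9⟩, -, hrow, hst, hm, hp, hsum, hdeg⟩ := hs
  have ha : s.mem (s.reg 12) = I.inputMem (n + s.reg 10 * n + s.reg 11) := by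
    rw [hm, hp, hs₀.input]
    have : (s₀.reg 10 + 1) * n ≤ n * n := Nat.mul_le_mul_right n hlt₀
    rw [hrow, base]
    rw [add_mul] at this
    omega
  have hle := I.inputMem_le_one (a := n + s.reg 10 * n + s.reg 11) (by omega)
  simp only [scanBody, block, wp, State.reg_setReg, f2]
  constructor <;> intro h <;> simp at h
  · have h1 : s.mem (s.reg 12) = 1 := by omega
    have h2 : I.inputMem (n + s.reg 10 * n + s.reg 11) = 1 := by omega
    refine ⟨⟨?_, ?_, ?_, ?_, ?_, ?_, ?_, ?_⟩, ?_⟩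
    · simp [Fixed, f0, f1, f2, f3, f4, f5, f6, f7, f8, f9]
    · simp [f1]; omega
    · simpa using hrow
    · simpa using hst
    · exact hm
    · simp [f1, hp]; ring
    · simp [f1, Finset.sum_range_succ, hsum, h2]
    · simp [f1, Finset.sum_range_succ, hdeg, h2]
    · simp [f1]; omega
  · have h2 : I.inputMem (n + s.reg 10 * n + s.reg 11) = 0 := by omega
    refine ⟨⟨?_, ?_, ?_, ?_, ?_, ?_, ?_, ?_⟩, ?_⟩
    · simp [Fixed, f0, f1, f2, f3, f4, f5, f6, f7, f8, f9]
    · simp [f1]; omega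
    · simpa using hrow
    · simpa using hst
    · exact hm
    · simp [f1, hp]; ring
    · simp [f1, Finset.sum_range_succ, hsum, h2]
    · simp [f1, Finset.sum_range_succ, hdeg, h2]
    · simp [f1]; omega

theorem scanEnd_wp {s₀ s : State} (hs₀ : ScanInv I s₀) (hlt₀ : s₀.reg 10 < n)
    (hs : ScanRowInv I s₀ s) (hend : s.reg 11 = n) :
    wp scanEnd s (fun s' => ScanInv I s' ∧ n - s'.reg 10 < n - s₀.reg 10) := by
  obtain ⟨⟨f0, f1, f2, f3, f4, f5, f6, f7, f8, f9⟩, -, hrow, hst, hm, hp, hsum, hdeg⟩ := hs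
  obtain ⟨-, -, -, gin, gsums, gzero, gstart⟩ := hs₀
  rw [hend] at hsum hdeg hp
  have hsum' : s.reg 13 = I.neighbourSum (fun j => j) (s.reg 10) := hsum
  have hdeg' : s.reg 14 = I.neighbourSum (fun _ => 1) (s.reg 10) := hdeg
  rw [← hrow] at gsums gstart hlt₀ ⊢
  rw [← hst] at gstart
  rw [← hm] at gin gsums gzero
  -- The two outcomes of the degree test differ only in register `15`, so the rest of the invariant
  -- is checked once.
  have hmem : ∀ t : State, t.reg 10 = s.reg 10 + 1 → Fixed n t → t.reg 12 = s.reg 12 →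
      (∀ a, t.mem a = if a = base n + s.reg 10 then s.reg 13 else s.mem a) →
      (∀ j < s.reg 10 + 1, I.neighbourSum (fun _ => 1) j < 2 →
        t.reg 15 < n ∧ I.neighbourSum (fun _ => 1) (t.reg 15) < 2) →
      ScanInv I t ∧ n - t.reg 10 < n - s.reg 10 := by
    intro t h10 hf h12 hmt hstart
    refine ⟨⟨hf, by omega, ?_, ?_, ?_, ?_, ?_⟩, by omega⟩
    · rw [h12, hp, h10]; ring
    · intro a ha
      rw [hmt, if_neg (by omega), gin a ha]
    · intro j hj
      rw [hmt]
      split_ifs with h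
      · rw [hsum', show j = s.reg 10 by omega]
      · exact gsums j (by omega)
    · intro a ha
      rw [hmt, if_neg (by omega), gzero a ha]
    · rw [h10]; exact hstart
  simp only [scanEnd, block, wp]
  constructor <;> intro h <;> simp [f3] at h <;> apply hmem
  · simp [f1]
  · simp [Fixed, f0, f1, f2, f3, f4, f5, f6, f7, f8, f9]
  · simp
  · intro a; simp [f5]
  · intro j hj hd
    simp only [State.reg_setReg, State.reg_setMem]
    simp [f2]
    exact ⟨hlt₀, by omega⟩
  · simp [f1]
  · simp [Fixed, f0, f1, f2, f3, f4, f5, f6, f7, f8, f9]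
  · simp
  · intro a; simp [f5]
  · intro j hj hd
    have : j < s.reg 10 := by
      rcases Nat.lt_succ_iff_lt_or_eq.1 hj with h' | rfl
      · exact h'
      · omega
    simpa using gstart j this hd

theorem scanProgram_ends {s : State} (hs : ScanInv I s) :
    Ends scanProgram s (n * (n * 10 + 16) + 1) (fun s' => ScanInv I s' ∧ s'.reg 10 = n) := by
  refine (Ends.while_measure (T := n * 10 + 15) (M := n) (ScanInv I) (fun s => n - s.reg 10) ?_ hs
      (Nat.sub_le _ _)).mono le_rfl ?_
  · intro s hs hlt
    rw [hs.fixed.1] at hlt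
    have h1 : Ends scanInit s 4 (ScanRowInv I s) := by
      refine (Ends.of_wp (P := scanInit) ?_).mono le_rfl fun s h => h
      obtain ⟨f0, f1, f2, f3, f4, f5, f6, f7, f8, f9⟩ := hs.fixed
      simp only [scanInit, block, wp]
      refine ⟨?_, ?_, ?_, ?_, ?_, ?_, ?_, ?_⟩
      · simp [Fixed, f0, f1, f2, f3, f4, f5, f6, f7, f8, f9]
      · simp
      · simp
      · simp
      · rfl
      · simp [hs.pointer]
      · simp
      · simp
    refine (h1.seq fun s₁ hs₁ => ((Ends.while_measure (T := 9) (M := n) (ScanRowInv I s)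
      (fun s => n - s.reg 11) ?_ hs₁ (Nat.sub_le _ _)).seq fun s₂ hs₂ =>
        Ends.of_wp (P := scanEnd) ?_)).mono (T := 4 + (n * 10 + 1 + 7)) (by omega) fun s h => h
    · intro s' hs' hlt'
      rw [hs'.fixed.1] at hlt'
      exact (Ends.of_wp (scanBody_wp hs hlt hs' hlt')).mono le_rfl fun s h => h
    · refine scanEnd_wp hs hlt hs₂.1 ?_
      have h1 := hs₂.2
      rw [hs₂.1.fixed.1] at h1
      have h2 := hs₂.1.le
      omega
  · rintro s' ⟨h1, h2⟩
    refine ⟨h1, ?_⟩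
    rw [h1.fixed.1] at h2
    have := h1.le
    omega

end CoupledTasks

namespace CoupledTasks

open RAM Program Instance

variable {n : ℕ} {I : Instance n} {f : Fin n ≃ Fin n}

/-! ### Walking along the path -/

def walkInit : Program := block [const 10 0, const 16 0]

/-- The next task is the neighbour sum of the current one (register `15`) minus the previous one
(register `16`). At the start register `16` holds `0`, so the sum, which has at most one term, is
left unchanged. -/
def walkBody : Program :=
  block [add 17 6 10, store 17 15, load 18 15, add 17 7 10, store 17 18, add 17 5 15, load 18 17,
    sub 18 18 16, add 16 15 2, add 15 18 2, add 10 10 1]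

def walkProgram : Program := .seq walkInit (.whileLt 10 0 walkBody)

/-- The first `s.reg 10` tasks along the path have been listed, together with their stretch
factors. -/
structure WalkInv (I : Instance n) (f : Fin n ≃ Fin n) (s : State) : Prop where
  fixed : Fixed n s
  le : s.reg 10 ≤ n
  tasks : ∀ a < n, s.mem a = I.inputMem a
  sums : ∀ j < n, s.mem (base n + j) = I.neighbourSum (fun j => j) j
  order : ∀ j < s.reg 10, s.mem (base n + (n + 3) + j) = taskAt f j
  stretches : ∀ j < n + 3, s.mem (base n + 2 * (n + 3) + j) =
    if j < s.reg 10 then I.stretchAt f j else 0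
  zero : ∀ a, base n + 3 * (n + 3) ≤ a → s.mem a = 0
  current : s.reg 10 < n → s.reg 15 = taskAt f (s.reg 10)
  previous : s.reg 16 = if 0 < s.reg 10 then taskAt f (s.reg 10 - 1) else 0

theorem le_base (n : ℕ) : n ≤ base n := Nat.le_add_right _ _

theorem walkBody_wp (hf : I.IsOrder f) {s : State} (hs : WalkInv I f s) (hlt : s.reg 10 < n) :
    wp walkBody s (fun s' => WalkInv I f s' ∧ n - s'.reg 10 < n - s.reg 10) := by
  obtain ⟨⟨f0, f1, f2, f3, f4, f5, f6, f7, f8, f9⟩, hle, htasks, hsums, hord, hstr, hzero,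
    hcur, hprev⟩ := hs
  have hb := le_base n
  have hcur := hcur hlt
  have hcn := taskAt_lt (f := f) hlt
  have hmem1 : s.mem (s.reg 15) = I.stretchAt f (s.reg 10) := by
    rw [hcur, htasks _ hcn, stretchAt, if_pos hlt]
  have hsum := hf.sum_adj (fun j => j) hlt
  have hmem2 : s.mem (base n + s.reg 15) =
      (if 0 < s.reg 10 then taskAt f (s.reg 10 - 1) else 0) +
        (if s.reg 10 + 1 < n then taskAt f (s.reg 10 + 1) else 0) := by
    rw [hcur, hsums _ hcn]
    exact hsum
  -- The cells read in this round are not among those written earlier in it.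
  have hne1 : s.reg 15 ≠ base n + (n + 3) + s.reg 10 := by omega
  have hne2 : base n + s.reg 15 ≠ base n + (n + 3) + s.reg 10 := by omega
  have hne3 : base n + s.reg 15 ≠ base n + 2 * (n + 3) + s.reg 10 := by omega
  have hpost : ∀ t : State, t.reg 10 = s.reg 10 + 1 → Fixed n t → t.reg 16 = s.reg 15 →
      t.reg 15 = s.mem (base n + s.reg 15) - s.reg 16 →
      (∀ a, t.mem a = if a = base n + 2 * (n + 3) + s.reg 10 then s.mem (s.reg 15) else
        if a = base n + (n + 3) + s.reg 10 then s.reg 15 else s.mem a) →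
      WalkInv I f t ∧ n - t.reg 10 < n - s.reg 10 := by
    intro t h10 hfix h16 h15 hm
    refine ⟨⟨hfix, by omega, ?_, ?_, ?_, ?_, ?_, ?_, ?_⟩, by omega⟩
    · intro a ha
      rw [hm, if_neg (by omega), if_neg (by omega), htasks a ha]
    · intro j hj
      rw [hm, if_neg (by omega), if_neg (by omega), hsums j hj]
    · intro j hj
      rw [hm, if_neg (by omega)]
      split_ifs with h
      · rw [hcur, show j = s.reg 10 by omega]
      · exact hord j (by omega)
    · intro j hj
      rw [hm]
      split_ifs with h1 h2 h3 h4 h5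
      · rw [hmem1, show j = s.reg 10 by omega]
      · omega
      · omega
      · omega
      · rw [hstr j hj, if_pos (by omega)]
      · rw [hstr j hj, if_neg (by omega)]
    · intro a ha
      rw [hm, if_neg (by omega), if_neg (by omega), hzero a ha]
    · intro h
      rw [h15, hprev, hmem2, h10, if_pos (show s.reg 10 + 1 < n by omega)]
      omega
    · rw [h16, h10, if_pos (by omega), hcur]
      rfl
  simp only [walkBody, block, wp]
  apply hpost
  · simp [f1]
  · simp [Fixed, f0, f1, f2, f3, f4, f5, f6, f7, f8, f9]
  · simp [f2]
  · simp [f2, f5, f6, f7, hne2, hne3]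
  · intro a
    simp [f6, f7, hne1]

theorem walkProgram_ends (hf : I.IsOrder f) {s : State} (hs : ScanInv I s) (hend : s.reg 10 = n)
    (hstart : 0 < n → s.reg 15 = taskAt f 0) :
    Ends walkProgram s (n * 13 + 4) (fun s' => WalkInv I f s' ∧ s'.reg 10 = n) := by
  have h1 : Ends walkInit s 3 (WalkInv I f) := by
    refine (Ends.of_wp (P := walkInit) ?_).mono le_rfl fun s h => h
    obtain ⟨⟨f0, f1, f2, f3, f4, f5, f6, f7, f8, f9⟩, -, -, hin, hsums, hzero, -⟩ := hs
    rw [hend] at hsums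
    have hb := le_base n
    have hz : ∀ a, base n + n ≤ a → s.mem a = 0 := hzero
    simp only [walkInit, block, wp]
    refine ⟨?_, ?_, ?_, ?_, ?_, ?_, ?_, ?_, ?_⟩
    · simp [Fixed, f0, f1, f2, f3, f4, f5, f6, f7, f8, f9]
    · simp
    · intro a ha
      exact hin a (by omega)
    · exact hsums
    · simp
    · intro j hj
      simpa using hz _ (by omega)
    · intro a ha
      exact hz a (by omega)
    · simpa using hstart
    · simp
  refine (h1.seq fun s hs => Ends.while_measure (T := 12) (M := n) (WalkInv I f)
    (fun s => n - s.reg 10) ?_ hs (Nat.sub_le _ _)).mono (by omega) ?_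
  · intro s hs hlt
    rw [hs.fixed.1] at hlt
    exact (Ends.of_wp (walkBody_wp hf hs hlt)).mono le_rfl fun s h => h
  · rintro s' ⟨h1, h2⟩
    refine ⟨h1, ?_⟩
    rw [h1.fixed.1] at h2
    have := h1.le
    omega

/-! ### The recurrence -/

/-- Registers `29` and `30` hold the best candidate and its code, starting with the single task `k`.
-/
def dpLoad : Program :=
  block [sub 10 10 1, add 17 7 10, load 20 17, add 17 17 1, load 21 17, add 17 17 1, load 22 17,
    add 17 8 10, add 17 17 1, load 23 17, add 17 17 1, load 24 17, add 17 17 1, load 25 17,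
    add 26 20 20, add 26 26 20, add 27 21 21, add 27 27 21, add 28 22 22, add 28 28 22,
    add 29 26 23, const 30 0]

/-- Take the candidate in register `31` if it is better. -/
def dpTake (code : ℕ) : Program := ifLt 31 29 (block [add 29 31 2, const 30 code]) skip

/-- Since `b k > 0`, the three orderings of `b k` and `b (k + 1)` separate the ways to pair these
tasks. The block of three is tried only after `3 * b k ≤ b (k + 1)` holds, which its own condition
implies; register `26` then becomes the sum of the two inner lengths. -/
def dpChoose : Program :=
  ifLt 20 21
    (ifLt 21 26 skip (block [add 31 27 24, dpTake 2,
      ifLt 2 22 (block [add 26 26 28, ifLt 21 26 skip (block [add 31 27 25, dpTake 3])]) skip]))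
    (ifLt 21 20
      (ifLt 2 21 (ifLt 20 27 skip (block [add 31 26 24, dpTake 1])) skip)
      (block [add 31 26 20, add 31 31 24, dpTake 1]))

def dpStore : Program := block [add 17 8 10, store 17 29, add 17 9 10, store 17 30]

def dpBody : Program := .seq dpLoad (.seq dpChoose dpStore)

def dpProgram : Program := .whileLt 2 10 dpBody

/-- The cells of the optimal values. -/
def valueAt (n : ℕ) (m : ℕ → ℕ) (k : ℕ) : ℕ := m (base n + 3 * (n + 3) + k)

/-- The cells of the choices. -/
def choiceAt (n : ℕ) (m : ℕ → ℕ) (k : ℕ) : ℕ := m (base n + 4 * (n + 3) + k)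

/-- The recurrence has been solved for the tasks from position `s.reg 10` on. -/
structure DPInv (I : Instance n) (f : Fin n ≃ Fin n) (s : State) : Prop where
  fixed : Fixed n s
  le : s.reg 10 ≤ n
  order : ∀ j < n, s.mem (base n + (n + 3) + j) = taskAt f j
  stretches : ∀ j < n + 3, s.mem (base n + 2 * (n + 3) + j) = I.stretchAt f j
  zero : ∀ j, n ≤ j → j < n + 3 → valueAt n s.mem j = 0
  step : ∀ j, s.reg 10 ≤ j → j < n →
    IsDPStep (I.stretchAt f) (valueAt n s.mem) (choiceAt n s.mem) j

/-- The data of one step of the recurrence have been loaded. -/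
structure DPLoaded (I : Instance n) (f : Fin n ≃ Fin n) (m : ℕ → ℕ) (k : ℕ) (s : State) :
    Prop where
  fixed : Fixed n s
  pos : s.reg 10 = k
  mem : s.mem = m
  x : s.reg 20 = I.stretchAt f k
  y : s.reg 21 = I.stretchAt f (k + 1)
  z : s.reg 22 = I.stretchAt f (k + 2)
  e : s.reg 24 = valueAt n m (k + 2)
  e' : s.reg 25 = valueAt n m (k + 3)
  x3 : s.reg 26 = 3 * I.stretchAt f k
  y3 : s.reg 27 = 3 * I.stretchAt f (k + 1)
  z3 : s.reg 28 = 3 * I.stretchAt f (k + 2)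
  best : s.reg 29 = 3 * I.stretchAt f k + valueAt n m (k + 1)
  code : s.reg 30 = 0

theorem dpLoad_wp {s : State} (hs : DPInv I f s) (hlt : 0 < s.reg 10) :
    wp dpLoad s (DPLoaded I f s.mem (s.reg 10 - 1)) := by
  obtain ⟨⟨f0, f1, f2, f3, f4, f5, f6, f7, f8, f9⟩, hle, hord, hstr, hzero, hstep⟩ := hs
  have hx := hstr (s.reg 10 - 1) (by omega)
  have hy := hstr (s.reg 10 - 1 + 1) (by omega)
  have hz := hstr (s.reg 10 - 1 + 2) (by omega)
  simp [dpLoad, block, wp, f1, f7, f8, add_assoc] at hx hy hz ⊢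
  constructor
  · simp [Fixed, f0, f1, f2, f3, f4, f5, f6, f7, f8, f9]
  · simp
  · rfl
  · simp [hx]
  · simp [hy]
  · simp [hz]
  · simp [valueAt, add_assoc]
  · simp [valueAt, add_assoc]
  · simp [hx]; ring
  · simp [hy]; ring
  · simp [hz]; ring
  · simp [hx, valueAt, add_assoc]; ring
  · simp

/-- The values found by the choice made at position `k`. -/
structure DPChosen (I : Instance n) (f : Fin n ≃ Fin n) (m : ℕ → ℕ) (k : ℕ) (s : State) :
    Prop where
  fixed : Fixed n s
  pos : s.reg 10 = k
  mem : s.mem = m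
  -- Quantified over `E` and `C` because the new value and choice are still in registers; the arrays
  -- after the store are substituted later.
  step : ∀ E C, (∀ j, k < j → j ≤ k + 3 → E j = valueAt n m j) → E k = s.reg 29 →
    C k = s.reg 30 → IsDPStep (I.stretchAt f) E C k

set_option maxHeartbeats 1000000 in
theorem dpChoose_wp {m : ℕ → ℕ} {k : ℕ} {s : State} (hs : DPLoaded I f m k s)
    (hpos : 0 < I.stretchAt f k) : wp dpChoose s (DPChosen I f m k) := by
  obtain ⟨⟨f0, f1, f2, f3, f4, f5, f6, f7, f8, f9⟩, h10, hm, hx, hy, hz, he, he', hx3, hy3, hz3,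
    hbest, hcode⟩ := hs
  have hpost : ∀ t : State, Fixed n t → t.reg 10 = k → t.mem = m →
      (∀ E C : ℕ → ℕ, E (k + 1) = valueAt n m (k + 1) → E (k + 2) = valueAt n m (k + 2) →
        E (k + 3) = valueAt n m (k + 3) → E k = t.reg 29 → C k = t.reg 30 →
        IsDPStep (I.stretchAt f) E C k) → DPChosen I f m k t :=
    fun t h1 h2 h3 h4 => ⟨h1, h2, h3, fun E C h5 h6 h7 => h4 E C (h5 _ (by omega) (by omega))
      (h5 _ (by omega) (by omega)) (h5 _ (by omega) (by omega)) h6 h7⟩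
  simp only [dpChoose, dpTake, block, wp]
  refine ⟨fun c1 => ⟨fun c2 => ?_, fun c2 => ⟨fun c3 => ⟨fun c4 => ⟨fun c5 => ?_, fun c5 =>
      ⟨fun c6 => ?_, fun c6 => ?_⟩⟩, fun c4 => ?_⟩, fun c3 => ⟨fun c4 => ⟨fun c5 => ?_, fun c5 =>
      ⟨fun c6 => ?_, fun c6 => ?_⟩⟩, fun c4 => ?_⟩⟩⟩,
    fun c1 => ⟨fun c2 => ⟨fun c3 => ⟨fun c4 => ?_, fun c4 => ⟨fun c5 => ?_, fun c5 => ?_⟩⟩,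
      fun c3 => ?_⟩, fun c2 => ⟨fun c3 => ?_, fun c3 => ?_⟩⟩⟩
  all_goals
    apply hpost
    · simp [Fixed, f0, f1, f2, f3, f4, f5, f6, f7, f8, f9]
    · simp [h10]
    · exact hm
    · intro E C h1 h2 h3 h4 h5
      clear f0 f1 f3 f4 f5 f6 f7 f8 f9
      simp [hx, hy, hz, he, he', hx3, hy3, hz3, hbest, hcode, f2] at *
      refine ⟨by omega, by omega, by omega, by omega, by omega, ?_⟩
      simp only [h5]
      simp
      omega

/-- Steps already solved survive a write at a smaller position. -/
theorem IsDPStep.congr {b E C E' C' : ℕ → ℕ} {k : ℕ} (h : IsDPStep b E C k)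
    (hE : ∀ j, k ≤ j → j ≤ k + 3 → E' j = E j) (hC : C' k = C k) : IsDPStep b E' C' k := by
  have h0 := hE k (by omega) (by omega)
  have h1 := hE (k + 1) (by omega) (by omega)
  have h2 := hE (k + 2) (by omega) (by omega)
  have h3 := hE (k + 3) (by omega) (by omega)
  obtain ⟨a, b, c, d, e, f⟩ := h
  constructor <;> simp only [h0, h1, h2, h3, hC] <;> assumption

theorem dpStore_wp {k : ℕ} {s s₀ : State} (hs₀ : DPInv I f s₀)
    (hk : s₀.reg 10 = k + 1) (hs : DPChosen I f s₀.mem k s) :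
    wp dpStore s (fun s' => DPInv I f s' ∧ s'.reg 10 < s₀.reg 10) := by
  obtain ⟨⟨f0, f1, f2, f3, f4, f5, f6, f7, f8, f9⟩, h10, hm, hchosen⟩ := hs
  obtain ⟨-, hle, hord, hstr, hzero, hstep⟩ := hs₀
  rw [hk] at hle hstep ⊢
  have hpost : ∀ t : State, t.reg 10 = k → Fixed n t →
      (∀ a, t.mem a = if a = base n + 4 * (n + 3) + k then s.reg 30 else
        if a = base n + 3 * (n + 3) + k then s.reg 29 else s₀.mem a) →
      DPInv I f t ∧ t.reg 10 < k + 1 := by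
    intro t h10 hfix hmt
    have hE : ∀ j, j ≠ k → j < n + 3 → valueAt n t.mem j = valueAt n s₀.mem j := by
      intro j h1 h2
      rw [valueAt, valueAt, hmt, if_neg (by omega), if_neg (by omega)]
    have hC : ∀ j, j ≠ k → choiceAt n t.mem j = choiceAt n s₀.mem j := by
      intro j h1
      rw [choiceAt, choiceAt, hmt, if_neg (by omega), if_neg (by omega)]
    refine ⟨⟨hfix, by omega, ?_, ?_, ?_, ?_⟩, by omega⟩
    · intro j hj
      rw [hmt, if_neg (by omega), if_neg (by omega), hord j hj]
    · intro j hj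
      rw [hmt, if_neg (by omega), if_neg (by omega), hstr j hj]
    · intro j hj hj'
      rw [hE j (by omega) hj', hzero j hj hj']
    · intro j hj hjn
      rw [h10] at hj
      rcases hj.eq_or_lt with rfl | hj
      · refine hchosen _ _ (fun j h1 h2 => hE j (by omega) (by omega)) ?_ ?_
        · rw [valueAt, hmt, if_neg (by omega), if_pos rfl]
        · rw [choiceAt, hmt, if_pos rfl]
      · exact (hstep j hj hjn).congr (fun i h1 h2 => hE i (by omega) (by omega))
          (hC j (by omega))
  simp only [dpStore, block, wp]
  apply hpost
  · simp [h10]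
  · simp [Fixed, f0, f1, f2, f3, f4, f5, f6, f7, f8, f9]
  · intro a
    simp [f8, f9, h10, hm]

theorem dpProgram_ends {s : State} (hs : WalkInv I f s) (hend : s.reg 10 = n) :
    Ends dpProgram s (n * 72 + 1) (fun s' => DPInv I f s' ∧ s'.reg 10 = 0) := by
  have h1 : DPInv I f s := by
    refine ⟨hs.fixed, hs.le, ?_, ?_, ?_, by omega⟩
    · intro j hj
      exact hs.order j (by omega)
    · intro j hj
      rw [hs.stretches j hj, hend]
      split_ifs with h
      · rfl
      · rw [stretchAt, if_neg h]
    · intro j _ _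
      exact hs.zero _ (by omega)
  refine (Ends.while_measure (T := 71) (M := n) (DPInv I f) (fun s => s.reg 10) ?_ h1
    hs.le).mono le_rfl ?_
  · intro s hs hlt
    rw [hs.fixed.2.2.1] at hlt
    have hle := hs.le
    have hwp : wp dpBody s (fun s' => DPInv I f s' ∧ s'.reg 10 < s.reg 10) := by
      simp only [dpBody, wp]
      refine wp_mono (dpLoad_wp hs hlt) fun s₁ hs₁ => ?_
      refine wp_mono (dpChoose_wp hs₁ ((stretchAt_pos_iff f _).2 (by omega))) fun s₂ hs₂ => ?_
      exact dpStore_wp hs (by omega) hs₂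
    exact (Ends.of_wp hwp).mono (by decide) fun s h => h
  · rintro s' ⟨h1, h2⟩
    rw [h1.fixed.2.2.1] at h2
    exact ⟨h1, by omega⟩

end CoupledTasks

namespace CoupledTasks

open RAM Program Instance

variable {n : ℕ} {I : Instance n} {f : Fin n ≃ Fin n}

/-! ### Writing the schedule -/

def assignInit : Program := block [const 10 0, load 32 8]

def assignLoad : Program :=
  block [add 17 6 10, load 20 17, add 17 17 1, load 21 17, add 17 17 1, load 22 17,
    add 17 7 10, load 23 17, add 17 17 1, load 24 17, add 17 8 10, load 25 17, sub 25 32 25,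
    add 17 9 10, load 26 17]

/-- Code `1` serves both interleaving and nesting of `k + 1` in `k`: in either case `k + 1` starts
`b k` after `k`. For codes `2` and `3` task `k + 1` comes first and `k` starts with its idle time;
for `3`, task `k + 2` follows `k` directly. -/
def assignStore : Program :=
  ifLt 26 1 (block [store 20 25, add 10 10 1])
    (ifLt 26 3 (block [store 20 25, add 25 25 23, store 21 25, add 10 10 3])
      (block [store 21 25, add 25 25 24, store 20 25,
        ifLt 26 4 (add 10 10 3)
          (block [add 25 25 23, add 25 25 23, add 25 25 23, store 22 25, add 10 10 4])]))

def assignBody : Program := .seq assignLoad assignStore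

/-- Register `0` serves as the loop bound until the end, when the optimal value replaces `n`. -/
def assignProgram : Program :=
  .seq assignInit (.seq (.whileLt 10 0 assignBody) (add 0 32 2))

/-- The tasks before position `s.reg 10` have been given their starting times. Here `m` is the
memory before the schedule is written. -/
structure AssignInv (I : Instance n) (f : Fin n ≃ Fin n) (m : ℕ → ℕ) (s : State) : Prop where
  fixed : Fixed n s
  total : s.reg 32 = valueAt n m 0
  mem : ∀ a, n ≤ a → s.mem a = m a
  placed : Placed n (I.stretchAt f) (valueAt n m) (fun j => s.mem (taskAt f j)) (s.reg 10)

/-- The data needed to place the next tasks have been loaded. -/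
structure AssignLoaded (I : Instance n) (f : Fin n ≃ Fin n) (m : ℕ → ℕ) (s₀ s : State) :
    Prop where
  fixed : Fixed n s
  total : s.reg 32 = valueAt n m 0
  mem : s.mem = s₀.mem
  pos : s.reg 10 = s₀.reg 10
  task : s.reg 20 = taskAt f (s₀.reg 10)
  task' : s₀.reg 10 + 1 < n → s.reg 21 = taskAt f (s₀.reg 10 + 1)
  task'' : s₀.reg 10 + 2 < n → s.reg 22 = taskAt f (s₀.reg 10 + 2)
  x : s.reg 23 = I.stretchAt f (s₀.reg 10)
  y : s.reg 24 = I.stretchAt f (s₀.reg 10 + 1)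
  time : s.reg 25 = valueAt n m 0 - valueAt n m (s₀.reg 10)
  code : s.reg 26 = choiceAt n m (s₀.reg 10)

theorem assignLoad_wp {s₁ : State} (hs₁ : DPInv I f s₁) {s : State}
    (hs : AssignInv I f s₁.mem s) (hlt : s.reg 10 < n) :
    wp assignLoad s (AssignLoaded I f s₁.mem s) := by
  obtain ⟨⟨f0, f1, f2, f3, f4, f5, f6, f7, f8, f9⟩, h32, hm, -⟩ := hs
  have hb := le_base n
  have hu := hs₁.order _ hlt
  -- The order array lists tasks only at positions below `n`; loads past the end return values that
  -- are never used.
  have hv : s.reg 10 + 1 < n → _ := hs₁.order (s.reg 10 + 1)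
  have hw : s.reg 10 + 2 < n → _ := hs₁.order (s.reg 10 + 2)
  have hx := hs₁.stretches (s.reg 10) (by omega)
  have hy := hs₁.stretches (s.reg 10 + 1) (by omega)
  have hm0 := hm (base n + (n + 3) + s.reg 10) (by omega)
  have hm1 := hm (base n + (n + 3) + (s.reg 10 + 1)) (by omega)
  have hm2 := hm (base n + (n + 3) + (s.reg 10 + 2)) (by omega)
  have hm3 := hm (base n + 2 * (n + 3) + s.reg 10) (by omega)
  have hm4 := hm (base n + 2 * (n + 3) + (s.reg 10 + 1)) (by omega)
  have hm5 := hm (base n + 3 * (n + 3) + s.reg 10) (by omega)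
  have hm6 := hm (base n + 4 * (n + 3) + s.reg 10) (by omega)
  simp [assignLoad, block, wp, f1, f6, f7, f8, f9, h32, add_assoc]
    at hu hv hw hx hy hm0 hm1 hm2 hm3 hm4 hm5 hm6 ⊢
  constructor
  · simp [Fixed, f0, f1, f2, f3, f4, f5, f6, f7, f8, f9]
  · simp [h32]
  · rfl
  · simp
  · simp [hm0, hu]
  · intro h
    simp [hm1, hv h]
  · intro h
    simp [hm2, hw h]
  · simp [hm3, hx]
  · simp [hm4, hy]
  · simp [hm5, valueAt, add_assoc]
  · simp [hm6, choiceAt, add_assoc]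

theorem assignStore_wp {s₁ : State} (hs₁ : DPInv I f s₁) (h₁ : s₁.reg 10 = 0) {s₀ : State}
    (hs₀ : AssignInv I f s₁.mem s₀) (hlt : s₀.reg 10 < n) {s : State}
    (hs : AssignLoaded I f s₁.mem s₀ s) :
    wp assignStore s (fun s' => AssignInv I f s₁.mem s' ∧ n - s'.reg 10 < n - s₀.reg 10) := by
  obtain ⟨⟨f0, f1, f2, f3, f4, f5, f6, f7, f8, f9⟩, h32, hm, h10, hu, hv, hw, hx, hy, ht, hc⟩ := hs
  obtain ⟨-, -, hm₀, hpl⟩ := hs₀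
  have hstep := hs₁.step (s₀.reg 10) (by omega) hlt
  have hb := fun k => stretchAt_pos_iff (I := I) f k
  have hcost := hpl.cost_le
  generalize hk : s₀.reg 10 = k at *
  generalize hE : valueAt n s₁.mem = E at *
  generalize hC : choiceAt n s₁.mem = C at *
  have hb1 := hb (k + 1)
  have hb2 := hb (k + 2)
  have hun := taskAt_lt (f := f) hlt
  have hpost : ∀ (r : ℕ) (t : State), 0 < r → t.reg 10 = k + r → Fixed n t →
      t.reg 32 = E 0 → (∀ a, n ≤ a → t.mem a = s₀.mem a) →
      Placed n (I.stretchAt f) E (fun j => t.mem (taskAt f j)) (k + r) →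
      AssignInv I f s₁.mem t ∧ n - t.reg 10 < n - k := by
    intro r t hr h10 hfix h32 hmt hplt
    refine ⟨⟨hfix, by rw [h32, hE], fun a ha => by rw [hmt a ha, hm₀ a ha], ?_⟩, by omega⟩
    rw [hE, h10]
    exact hplt
  -- The code selects the attained alternative, whose positivity conditions guarantee that the block
  -- ends within the path.
  have hatt := hstep.attained
  simp only [assignStore, block, wp]
  refine ⟨fun c1 => ?_, fun c1 => ⟨fun c2 => ?_, fun c2 => ⟨fun c3 => ?_, fun c3 => ?_⟩⟩⟩
  · simp only [f1, hc] at c1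
    refine hpost 1 _ one_pos ?_ ?_ ?_ ?_ ?_
    · simp [h10, f1]
    · simp [Fixed, f0, f1, f2, f3, f4, f5, f6, f7, f8, f9]
    · simp [h32]
    · intro a ha
      simp only [State.mem_setReg, State.mem_setMem, hu, hm]
      rw [if_neg (by omega)]
    · simp only [State.mem_setReg, State.mem_setMem, hu, hm, ht]
      refine hpl.extend_one hlt (by omega) ?_ ?_
      · intro j hj
        rw [if_neg (by rw [taskAt_inj] <;> omega)]
      · rw [if_pos rfl]
  · simp only [f1, f3, hc] at c1 c2
    have hk1 : k + 1 < n := by omega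
    have hv := hv hk1
    have hvn := taskAt_lt (f := f) hk1
    have hne : taskAt f k ≠ taskAt f (k + 1) := by rw [Ne, taskAt_inj hlt hk1]; omega
    refine hpost 2 _ two_pos ?_ ?_ ?_ ?_ ?_
    · simp [h10, f3]
    · simp [Fixed, f0, f1, f2, f3, f4, f5, f6, f7, f8, f9]
    · simp [h32]
    · intro a ha
      simp
      rw [hu, hv, hm, if_neg (by omega), if_neg (by omega)]
    · simp [hu, hv, hm, ht, hx]
      refine hpl.extend_two hk1 (by omega) ?_ ?_ ?_ ?_
      · intro j hj
        rw [if_neg (by rw [taskAt_inj] <;> omega), if_neg (by rw [taskAt_inj] <;> omega)]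
      · rw [if_neg hne, if_pos rfl]
        omega
      · rw [if_pos rfl]
        omega
      · rw [if_neg hne, if_pos rfl, if_pos rfl]
        unfold Fits Inside Interleaved
        omega
  · simp only [f1, f3, f4, hc, State.reg_setReg, State.reg_setMem] at c1 c2 c3
    simp at c3
    have hk1 : k + 1 < n := by omega
    have hv := hv hk1
    have hvn := taskAt_lt (f := f) hk1
    have hne : taskAt f k ≠ taskAt f (k + 1) := by rw [Ne, taskAt_inj hlt hk1]; omega
    refine hpost 2 _ two_pos ?_ ?_ ?_ ?_ ?_
    · simp [h10, f3]
    · simp [Fixed, f0, f1, f2, f3, f4, f5, f6, f7, f8, f9]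
    · simp [h32]
    · intro a ha
      simp
      rw [hu, hv, hm, if_neg (by omega), if_neg (by omega)]
    · simp [hu, hv, hm, ht, hy]
      refine hpl.extend_two hk1 (by omega) ?_ ?_ ?_ ?_
      · intro j hj
        rw [if_neg (by rw [taskAt_inj] <;> omega), if_neg (by rw [taskAt_inj] <;> omega)]
      · rw [if_pos rfl]
        omega
      · rw [if_neg hne.symm, if_pos rfl]
        omega
      · rw [if_pos rfl, if_neg hne.symm, if_pos rfl]
        unfold Fits Inside Interleaved
        omega
  · simp only [f1, f3, f4, hc, State.reg_setReg, State.reg_setMem] at c1 c2 c3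
    simp at c3
    have hk1 : k + 1 < n := by omega
    have hk2 : k + 2 < n := by omega
    have hv := hv hk1
    have hw := hw hk2
    have hvn := taskAt_lt (f := f) hk1
    have hwn := taskAt_lt (f := f) hk2
    have hne : taskAt f k ≠ taskAt f (k + 1) := by rw [Ne, taskAt_inj hlt hk1]; omega
    have hne' : taskAt f k ≠ taskAt f (k + 2) := by rw [Ne, taskAt_inj hlt hk2]; omega
    have hne'' : taskAt f (k + 1) ≠ taskAt f (k + 2) := by rw [Ne, taskAt_inj hk1 hk2]; omega
    refine hpost 3 _ three_pos ?_ ?_ ?_ ?_ ?_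
    · simp [h10, f4]
    · simp [Fixed, f0, f1, f2, f3, f4, f5, f6, f7, f8, f9]
    · simp [h32]
    · intro a ha
      simp
      rw [hu, hv, hw, hm, if_neg (by omega), if_neg (by omega), if_neg (by omega)]
    · simp [hu, hv, hw, hm, ht, hx, hy]
      refine hpl.extend_three hk2 (by omega) (by omega) ?_ ?_ ?_ ?_
      · intro j hj
        rw [if_neg (by rw [taskAt_inj] <;> omega), if_neg (by rw [taskAt_inj] <;> omega),
          if_neg (by rw [taskAt_inj] <;> omega)]
      · rw [if_neg hne', if_pos rfl]
      · rw [if_neg hne'', if_neg hne.symm, if_pos rfl]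
      · rw [if_pos rfl]
        ring

theorem assignProgram_ends {s : State} (hs : DPInv I f s) (h10 : s.reg 10 = 0) :
    Ends assignProgram s (n * 40 + 5) (fun s' =>
      Placed n (I.stretchAt f) (valueAt n s.mem) (fun j => s'.mem (taskAt f j)) n ∧
        s'.reg 0 = valueAt n s.mem 0) := by
  have h1 : Ends assignInit s 3 (AssignInv I f s.mem) := by
    refine (Ends.of_wp (P := assignInit) ?_).mono le_rfl fun s h => h
    obtain ⟨f0, f1, f2, f3, f4, f5, f6, f7, f8, f9⟩ := hs.fixed
    simp only [assignInit, block, wp]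
    refine ⟨?_, ?_, ?_, ?_⟩
    · simp [Fixed, f0, f1, f2, f3, f4, f5, f6, f7, f8, f9]
    · simp [f8, valueAt]
    · intro a _
      rfl
    · exact Placed.zero _ _ _ _
  refine (h1.seq fun s₁ hs₁ => (Ends.while_measure (T := 39) (M := n) (AssignInv I f s.mem)
    (fun s => n - s.reg 10) ?_ hs₁ (Nat.sub_le _ _)).seq fun s₂ hs₂ =>
      Ends.of_wp (P := add 0 32 2) ?_).mono (T := 3 + (n * 40 + 1 + 1)) (by omega) fun s h => h
  · intro s' hs' hlt
    rw [hs'.fixed.1] at hlt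
    have hwp : wp assignBody s' (fun t => AssignInv I f s.mem t ∧ n - t.reg 10 < n - s'.reg 10) := by
      simp only [assignBody, wp]
      exact wp_mono (assignLoad_wp hs hs' hlt) fun t ht => assignStore_wp hs h10 hs' hlt ht
    exact (Ends.of_wp hwp).mono (by decide) fun s h => h
  · obtain ⟨⟨hfix, h32, -, hpl⟩, hend⟩ := hs₂
    have hle := hpl.le
    rw [hfix.1] at hend
    have h10' : s₂.reg 10 = n := by omega
    rw [h10'] at hpl
    simp only [wp]
    exact ⟨hpl, by simp [h32, hfix.2.2.1]⟩

/-! ### The whole program -/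

def chainProgram : Program :=
  .seq initProgram (.seq scanProgram (.seq walkProgram (.seq dpProgram assignProgram)))

theorem chainProgram_ends (hI : I.IsChain) :
    Ends chainProgram I.input (n * (n * 10 + 145) + 25) (fun s =>
      I.IsOptimal (fun i => (s.mem i : ℝ)) ∧
        I.makespan (fun i => (s.mem i : ℝ)) = s.reg 0) := by
  have h1 : Ends initProgram I.input (n * 4 + 14) (ScanInv I) := by
    refine (initProgram_ends I).mono le_rfl ?_
    rintro s ⟨hfix, h10, h12, h15, hm⟩
    refine ⟨hfix, by omega, by rw [h12, h10]; ring, fun a _ => by rw [hm], by omega, ?_, by omega⟩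
    intro a ha
    rw [hm]
    exact I.inputMem_of_ge (by rw [base] at ha; omega)
  refine (h1.seq fun s₁ hs₁ => (scanProgram_ends hs₁).seq (T₂ := n * 125 + 10)
    fun s₂ ⟨hs₂, hend⟩ => ?_).mono ?_ fun s h => h
  -- The order is fixed only now: of the orders of the path, one starting at the end found by the
  -- scan is taken.
  · have hord : ∃ f, I.IsOrder f ∧ (0 < n → s₂.reg 15 = taskAt f 0) := by
      rcases Nat.eq_zero_or_pos n with hn | hn
      · obtain ⟨f, hf⟩ := hI.exists_isOrder
        exact ⟨f, hf, by omega⟩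
      · obtain ⟨i, hi, hdeg⟩ := hI.exists_end hn
        obtain ⟨h3, h4⟩ := hs₂.start i (by omega) hdeg
        obtain ⟨f, hf, hf0⟩ := hI.exists_isOrder_from h3 h4
        exact ⟨f, hf, fun _ => hf0.symm⟩
    obtain ⟨f, hf, hstart⟩ := hord
    refine ((walkProgram_ends hf hs₂ hend hstart).seq fun s₃ hs₃ =>
      (dpProgram_ends hs₃.1 hs₃.2).seq fun s₄ hs₄ =>
        (assignProgram_ends hs₄.1 hs₄.2).mono le_rfl ?_).mono
          (T := n * 13 + 4 + (n * 72 + 1 + (n * 40 + 5))) (by omega) fun s h => h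
    rintro s ⟨hpl, h0⟩
    have := hf.isOptimal (hs₄.1.zero n le_rfl (by omega))
      (fun k hk => hs₄.1.step k (by omega) hk) hpl
    rw [h0]
    exact this
  · ring_nf
    omega

/-! ### Size bounds and the final theorem -/

theorem constSizeLE_chainProgram : ConstSizeLE 2 chainProgram := by
  simp [chainProgram, initProgram, initConsts, squareBody, initBases, scanProgram, scanRow,
    scanInit, scanBody, scanEnd, walkProgram, walkInit, walkBody, dpProgram, dpBody, dpLoad,
    dpChoose, dpTake, dpStore, assignProgram, assignInit, assignBody, assignLoad, assignStore,
    block, ConstSizeLE]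
  decide

theorem Instance.le_inputLength (I : Instance n) : n ≤ I.inputLength := by
  have : n ≤ n * n := Nat.le_mul_self n
  unfold inputLength
  omega

theorem Instance.sizeLE_input (I : Instance n) : I.input.SizeLE (I.inputLength + 2) := by
  refine ⟨fun x => ?_, fun a => (I.size_inputMem_le a).trans (by omega)⟩
  simp only [input]
  split_ifs
  · unfold inputLength
    omega
  · simp

end CoupledTasks

theorem theorem2p1 :
    ∃ (P : RAM.Program) (C : ℕ) (q : Polynomial ℕ),
      ∀ (n : ℕ) (I : CoupledTasks.Instance n), I.IsChain →
        ∃ (t c : ℕ) (σ : RAM.State),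
          RAM.Exec P I.input t c σ ∧
          t ≤ C * (n ^ 3 + 1) ∧
          c ≤ q.eval I.inputLength ∧
          I.IsOptimal (fun i => (σ.mem i : ℝ)) ∧
          I.makespan (fun i => (σ.mem i : ℝ)) = σ.reg 0 := by
  -- `180 = 10 + 145 + 25` sums the coefficients of the step bound. The polynomial is `t * (1 + 2 *
  -- (B + t))` from `Exec.cost_le`, with `B` two more than the input length and `t` replaced by its
  -- bound, in which `n` is at most the input length.
  refine ⟨CoupledTasks.chainProgram, 180,
    180 * (.X ^ 3 + 1) * (1 + 2 * (.X + 2 + 180 * (.X ^ 3 + 1))), fun n I hI => ?_⟩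
  obtain ⟨t, c, σ, he, ht, hopt⟩ := CoupledTasks.chainProgram_ends hI
  have hn : t ≤ 180 * (n ^ 3 + 1) := by
    refine ht.trans ?_
    rcases Nat.eq_zero_or_pos n with rfl | hn
    · simp
    · have h1 : n ≤ n ^ 3 := Nat.le_self_pow (by norm_num) n
      have h2 : n ^ 2 ≤ n ^ 3 := Nat.pow_le_pow_right hn (by norm_num)
      have h3 : n * (n * 10 + 145) + 25 = 10 * n ^ 2 + 145 * n + 25 := by ring
      omega
  refine ⟨t, c, σ, he, hn, ?_, hopt⟩
  have hc := (he.cost_le _ (CoupledTasks.constSizeLE_chainProgram.mono (by omega))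
    I.sizeLE_input).2
  have hL : t ≤ 180 * (I.inputLength ^ 3 + 1) := by
    have := Nat.pow_le_pow_left I.le_inputLength 3
    omega
  simp only [Polynomial.eval_mul, Polynomial.eval_add, Polynomial.eval_pow, Polynomial.eval_X,
    Polynomial.eval_one, Polynomial.eval_ofNat]
  refine hc.trans ?_
  gcongr
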